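/- Let $\mathcal S,\mathcal A$ be finite sets and $\tau\ge 1$ an integer. An MDP is $M=(R^M,P^M,\rho^M)$, where for each $s\in\mathcal S$, $a\in\mathcal A$, $R^M_a(s)$ is a probability law on $[0,1]$ (the reward law), $P^M_a(\cdot\mid s)$ is a probability law on $\mathcal S$ (the transition law), and $\rho^M$ is a probability law on $\mathcal S$ (the initial law). MDPs carry the $\sigma$-algebra generated by the maps $M\mapsto R^M_a(s)(B)$, $M\mapsto P^M_a(s'\mid s)$, $M\mapsto\rho^M(s)$. A policy is a map $\mu:\mathcal S\times\{1,\dots,\tau\}\to\mathcal A$, with value $$V^M_{\mu,i}(s)=\mathbb E_{M,\mu}\Big[\sum_{j=i}^{\tau}\overline R^M_{a_j}(s_j)\,\Big|\,s_i=s\Big],\qquad a_j=\mu(s_j,j),\quad s_{j+1}\sim P^M_{a_j}(\cdot\mid s_j),$$ where $\overline R^M_a(s)$ is the mean of $R^M_a(s)$. A policy $\mu$ is optimal for $M$ if $V^M_{\mu,i}(s)=\max_{\mu'}V^M_{\mu',i}(s)$ for all $s$ and $i$. Let $M\mapsto\mu^M$ be a measurable map that assigns to each MDP $M$ a policy optimal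 for $M$. Let $f$ be a probability measure (the prior) on MDPs. Posterior sampling for reinforcement learning (PSRL) with prior $f$ runs as follows. The true MDP $M^*$ is drawn from $f$. Episode $k=1,2,\dots$ occupies the times $t_k,\dots,t_k+\tau-1$, where $t_k=(k-1)\tau+1$. At its start, given the history $H_{t_k}=(s_t,a_t,r_t)_{t<t_k}$, an MDP $M_k$ is drawn from the posterior law $f(\cdot\mid H_{t_k})$ of $M^*$, independently of $M^*$ and $M_1,\dots,M_{k-1}$ given $H_{t_k}$, and one sets $\mu_k=\mu^{M_k}$. Then $s_{t_k}\sim\rho^{M^*}$, and for $t=t_k,\dots,t_k+\tau-1$: $a_t=\mu_k(s_t,t-t_k+1)$, $r_t\sim R^{M^*}_{a_t}(s_t)$ and, if $t<t_k+\tau-1$, $s_{t+1}\sim P^{M^*}_{a_t}(\cdot\mid s_t)$; each of these draws is conditional on $M^*$ and everything drawn earlier. Put $$\mathrm{Regret}(T)=\sum_{k=1}^{\lceil T/\tau\rceil}\Delta_k,\qquad \Delta_k=\sum_{s\in\mathcal S}\rho^{M^*}(s)\big(V^{M^*}_{\mu^{M^*},1}(s)-V^{M^*}_{\mu_k,1}(s)\big).$$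 Let $\mathcal M$ be any measurable family of MDPs with $f(\mathcal M)>0$. Then for every $\epsilon>0$ and every $\alpha>\tfrac12$, $$\mathbb P\left(\frac{\mathrm{Regret}(T)}{T^\alpha}>\epsilon\;\Big|\;M^*\in\mathcal M\right)\longrightarrow 0\qquad\text{as } T\to\infty,\ T\in\mathbb N.$$ -/

import Mathlib

open MeasureTheory ProbabilityTheory Filter Topology

noncomputable section

/-- A Markov decision process with state space `S` and action space `A` (the horizon is a separate,
deterministic parameter): for each state `s` and action `a` a reward law on `[0,1]` and a transition
law on `S`, and a law on `S` for the first state of an episode. -/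
structure MDP (S A : Type*) [Fintype S] where
  reward : S → A → ProbabilityMeasure (Set.Icc (0 : ℝ) 1)
  trans : S → A → stdSimplex ℝ S
  init : stdSimplex ℝ S

/-- The σ-algebra on MDPs generated by the maps `M ↦ R^M_a(s)(B)` (for `B` Borel),
`M ↦ P^M_a(s' | s)` and `M ↦ ρ^M(s)`. -/
instance {S A : Type*} [Fintype S] : MeasurableSpace (MDP S A) :=
  MeasurableSpace.comap
    (fun M : MDP S A =>
      ((fun s a => (M.reward s a : Measure (Set.Icc (0 : ℝ) 1))),
        (fun s a s' => M.trans s a s'), (fun s => M.init s)))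
    (inferInstance : MeasurableSpace
      ((S → A → Measure (Set.Icc (0 : ℝ) 1)) × (S → A → S → ℝ) × (S → ℝ)))

/-- Deterministic policies: an action for each state and each of the `τ` steps of an episode
(the steps are numbered `0, …, τ - 1`). -/
abbrev Policy (S A : Type*) (τ : ℕ) : Type _ := S → Fin τ → A

namespace MDP

variable {S A : Type*} [Fintype S] {τ : ℕ}

/-- The expected reward for action `a` in state `s`. -/
def meanReward (M : MDP S A) (s : S) (a : A) : ℝ :=
  ∫ x, (x : ℝ) ∂(M.reward s a : Measure (Set.Icc (0 : ℝ) 1))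

/-- Step `i + j` of an episode, where `i` is a step and `j ≤ τ - 1 - i`. -/
def stepAdd (i : Fin τ) (j : Fin (τ - 1 - i + 1)) : Fin τ :=
  ⟨i + j, by have := i.isLt; have := j.isLt; omega⟩

/-- The probability that the states at the steps `i, i + 1, …, τ - 1` are
`x 0, x 1, …, x (τ - 1 - i)`, given that the state at step `i` is `x 0` and that `μ` is followed. -/
def pathProb (M : MDP S A) (μ : Policy S A τ) (i : Fin τ) (x : Fin (τ - 1 - i + 1) → S) : ℝ :=
  ∏ j : Fin (τ - 1 - i),
    M.trans (x j.castSucc) (μ (x j.castSucc) (stepAdd i j.castSucc)) (x j.succ)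

/-- The value function `V^M_{μ,i}(s)`: the expectation, over the state paths that start from `s` at
step `i` and are generated by `M` under `μ`, of the sum of the mean rewards from step `i` to the end
of the episode. -/
def value (M : MDP S A) (μ : Policy S A τ) (i : Fin τ) (s : S) : ℝ :=
  ∑ y : Fin (τ - 1 - i) → S,
    let x : Fin (τ - 1 - i + 1) → S := Fin.cons s y
    M.pathProb μ i x * ∑ j, M.meanReward (x j) (μ (x j) (stepAdd i j))

/-- `μ` is optimal for `M`: its value is maximal from every state and every step. -/
def IsOptimal (M : MDP S A) (μ : Policy S A τ) : Prop :=
  ∀ (s : S) (i : Fin τ), IsGreatest (Set.range fun μ' : Policy S A τ => M.value μ' i s)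
    (M.value μ i s)

/-- The regret over one episode in the MDP `M` of following `μ` instead of `μopt`. -/
def episodeRegret [NeZero τ] (M : MDP S A) (μopt μ : Policy S A τ) : ℝ :=
  ∑ s, M.init s * (M.value μopt 0 s - M.value μ 0 s)

end MDP

namespace PSRL

variable {S A Ω : Type*} [Fintype S] {τ : ℕ} [NeZero τ]

/-- The action at time `t`. Times and episodes are numbered from `0`: episode `k` consists of the
times `k τ, …, k τ + τ - 1`, so time `t` is step `t % τ` of episode `t / τ`, in which the agent
follows the policy `polOf (M (t / τ))` of the MDP sampled for that episode. -/
def action (polOf : MDP S A → Policy S A τ) (M : ℕ → Ω → MDP S A) (s : ℕ → Ω → S)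
    (t : ℕ) (ω : Ω) : A :=
  polOf (M (t / τ) ω) (s t ω) (Fin.ofNat τ t)

/-- The history of the states, actions and rewards at the times before `t`. -/
def history (polOf : MDP S A → Policy S A τ) (M : ℕ → Ω → MDP S A) (s : ℕ → Ω → S)
    (r : ℕ → Ω → Set.Icc (0 : ℝ) 1) (t : ℕ) (ω : Ω) : Fin t → S × A × Set.Icc (0 : ℝ) 1 :=
  fun j => (s j ω, action polOf M s j ω, r j ω)

/-- The σ-algebra generated by the true MDP, the MDPs sampled for the first `n` episodes and the
history before time `t`. -/
abbrev info [MeasurableSpace S] [MeasurableSpace A] (polOf : MDP S A → Policy S A τ)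
    (Mstar : Ω → MDP S A) (M : ℕ → Ω → MDP S A) (s : ℕ → Ω → S)
    (r : ℕ → Ω → Set.Icc (0 : ℝ) 1) (n t : ℕ) : MeasurableSpace Ω :=
  MeasurableSpace.comap
    (fun ω => (Mstar ω, (fun j : Fin n => M j ω), history polOf M s r t ω)) inferInstance

/-- The random variables `Mstar` (the true MDP), `M k` (the MDP sampled for episode `k`), `s t` (the
state at time `t`) and `r t` (the reward at time `t`) on the probability space `(Ω, P)` form a run of
posterior sampling for reinforcement learning with prior `f`, where the true MDP has law `f`. -/
structure IsRun [MeasurableSpace S] [MeasurableSpace A] [MeasurableSpace Ω] (P : Measure Ω)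
    (f : Measure (MDP S A)) (polOf : MDP S A → Policy S A τ) (Mstar : Ω → MDP S A)
    (M : ℕ → Ω → MDP S A) (s : ℕ → Ω → S) (r : ℕ → Ω → Set.Icc (0 : ℝ) 1) : Prop where
  measurable_true : Measurable Mstar
  measurable_sample : ∀ k, Measurable (M k)
  measurable_state : ∀ t, Measurable (s t)
  measurable_reward : ∀ t, Measurable (r t)
  /-- The true MDP is distributed according to the prior. -/
  law_true : P.map Mstar = f
  /-- At the start of episode `k`, `M k` is drawn from the posterior law of the true MDP given the
  history; given the history, the draw is independent of the true MDP and of the earlier draws. -/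
  posterior : ∀ (k : ℕ) (B : Set (MDP S A)), MeasurableSet B →
    P⟦M k ⁻¹' B | info polOf Mstar M s r k (k * τ)⟧ =ᵐ[P]
      P⟦Mstar ⁻¹' B | MeasurableSpace.comap (history polOf M s r (k * τ)) inferInstance⟧
  /-- The first state of each episode is drawn from the initial law of the true MDP. -/
  initial : ∀ (k : ℕ) (x : S),
    P⟦s (k * τ) ⁻¹' {x} | info polOf Mstar M s r (k + 1) (k * τ)⟧ =ᵐ[P]
      fun ω => (Mstar ω).init x
  /-- The reward at time `t` is drawn from the reward law of the true MDP. -/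
  reward : ∀ (t : ℕ) (B : Set (Set.Icc (0 : ℝ) 1)), MeasurableSet B →
    P⟦r t ⁻¹' B |
        info polOf Mstar M s r (t / τ + 1) t ⊔ MeasurableSpace.comap (s t) inferInstance⟧ =ᵐ[P]
      fun ω => ((Mstar ω).reward (s t ω) (action polOf M s t ω) :
        Measure (Set.Icc (0 : ℝ) 1)).real B
  /-- Within an episode, the next state is drawn from the transition law of the true MDP. -/
  transition : ∀ (t : ℕ) (x : S), ¬ τ ∣ t + 1 →
    P⟦s (t + 1) ⁻¹' {x} | info polOf Mstar M s r (t / τ + 1) (t + 1)⟧ =ᵐ[P]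
      fun ω => (Mstar ω).trans (s t ω) (action polOf M s t ω) x

/-- The regret up to time `T`: the sum of the episode regrets of the first `⌈T / τ⌉` episodes. -/
def regret (polOf : MDP S A → Policy S A τ) (Mstar : Ω → MDP S A) (M : ℕ → Ω → MDP S A)
    (T : ℕ) (ω : Ω) : ℝ :=
  ∑ k ∈ Finset.range ⌈(T : ℝ) / τ⌉₊,
    (Mstar ω).episodeRegret (polOf (Mstar ω)) (polOf (M k ω))

end PSRL

end

/-! The expected regret under the prior is `O(√T log T)`. The regret is nonnegative because `polOf`
returns optimal policies, so Markov's inequality gives convergence in probability for every `α >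
1/2`. Conditioning on an event of probability `f 𝓜 > 0` multiplies probabilities by at most `1 / f
𝓜`.

For the expected regret, `M k` and `Mstar` have the same law given the history at the start of
episode `k` (`map_sample_prod_eq`). Hence the optimal value of `Mstar` may be replaced in
expectation by the value that `M k` assigns to its own policy. What remains is the value of one
policy in two MDPs. Unrolling it along the true trajectory (`integral_value_diff_le`) bounds it by
the errors of the sampled initial law, mean rewards and transition probabilities at the states and
actions actually visited.

Each of these parameters is a number in `[0,1]`, observed with conditionally unbiased noise at its
visits. No confidence sets are needed; a second moment suffices. With `N` visits so far, `(N + 1) *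
(empirical mean - parameter)^2` has expectation `O(log n)` for the true parameter: its increments
are a centred cross term plus at most `1 / (N + 1)` at each visit (`sqDev_succ_le`,
`integral_sqDev_le`). The empirical mean at the start of an episode is a function of the history, so
the sampled parameter satisfies the same bound. An arithmetic-geometric mean inequality with weight
`√n`, together with the harmonic sum over visits, then bounds the summed absolute errors by `√n log
n` (`sum_integral_visit_mul_abs_le`). -/

noncomputable section

/-! ### Values by backward recursion: Bellman equations, bounds and measurability. -/

namespace MDP

variable {S A : Type*} [Fintype S] {τ : ℕ}

theorem measurable_data :
    Measurable (fun M : MDP S A =>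
      ((fun s a => (M.reward s a : Measure (Set.Icc (0 : ℝ) 1))),
        (fun s a s' => M.trans s a s'), (fun s => M.init s))) :=
  comap_measurable _

theorem measurable_reward (s : S) (a : A) :
    Measurable fun M : MDP S A => (M.reward s a : Measure (Set.Icc (0 : ℝ) 1)) :=
  (measurable_pi_apply a).comp ((measurable_pi_apply s).comp measurable_data.fst)

theorem measurable_trans (s : S) (a : A) (x : S) :
    Measurable fun M : MDP S A => M.trans s a x :=
  (measurable_pi_apply x).comp
    ((measurable_pi_apply a).comp ((measurable_pi_apply s).comp measurable_data.snd.fst))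

theorem measurable_init (x : S) : Measurable fun M : MDP S A => M.init x :=
  (measurable_pi_apply x).comp measurable_data.snd.snd

theorem meanReward_eq_lintegral (M : MDP S A) (s : S) (a : A) :
    M.meanReward s a =
      (∫⁻ x, ENNReal.ofReal (x : ℝ) ∂(M.reward s a : Measure (Set.Icc (0 : ℝ) 1))).toReal := by
  rw [meanReward, integral_eq_lintegral_of_nonneg_ae (ae_of_all _ fun x => x.2.1)
    measurable_subtype_coe.aestronglyMeasurable]

theorem measurable_meanReward (s : S) (a : A) :
    Measurable fun M : MDP S A => M.meanReward s a := by
  simp_rw [meanReward_eq_lintegral]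
  exact ((Measure.measurable_lintegral measurable_subtype_coe.ennreal_ofReal).comp
    (measurable_reward s a)).ennreal_toReal

theorem meanReward_nonneg (M : MDP S A) (s : S) (a : A) : 0 ≤ M.meanReward s a :=
  integral_nonneg fun x => x.2.1

theorem meanReward_le_one (M : MDP S A) (s : S) (a : A) : M.meanReward s a ≤ 1 := by
  have h : M.meanReward s a ≤ ∫ _, (1 : ℝ) ∂(M.reward s a : Measure (Set.Icc (0 : ℝ) 1)) :=
    integral_mono_of_nonneg (ae_of_all _ fun x => x.2.1) (integrable_const _)
      (ae_of_all _ fun x => x.2.2)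
  simpa using h

theorem trans_nonneg (M : MDP S A) (s : S) (a : A) (x : S) : 0 ≤ M.trans s a x :=
  (M.trans s a).2.1 x

theorem sum_trans (M : MDP S A) (s : S) (a : A) : ∑ x, M.trans s a x = 1 :=
  (M.trans s a).2.2

theorem trans_le_one (M : MDP S A) (s : S) (a : A) (x : S) : M.trans s a x ≤ 1 := by
  rw [← M.sum_trans s a]
  exact Finset.single_le_sum (fun y _ => M.trans_nonneg s a y) (Finset.mem_univ x)

theorem init_nonneg (M : MDP S A) (x : S) : 0 ≤ M.init x := M.init.2.1 x

theorem sum_init (M : MDP S A) : ∑ x, M.init x = 1 := M.init.2.2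

theorem init_le_one (M : MDP S A) (x : S) : M.init x ≤ 1 := by
  rw [← M.sum_init]
  exact Finset.single_le_sum (fun y _ => M.init_nonneg y) (Finset.mem_univ x)

/-- The expected total reward over `n + 1` steps from state `s`, by backward recursion, when the
decision rule `g j` is used at step `j`. -/
def rollout (M : MDP S A) : (n : ℕ) → (ℕ → S → A) → S → ℝ
  | 0, g, s => M.meanReward s (g 0 s)
  | n + 1, g, s => M.meanReward s (g 0 s) +
      ∑ x, M.trans s (g 0 s) x * M.rollout n (fun j => g (j + 1)) x

theorem rollout_nonneg (M : MDP S A) (n : ℕ) (g : ℕ → S → A) (s : S) :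
    0 ≤ M.rollout n g s := by
  induction n generalizing g s with
  | zero => exact M.meanReward_nonneg _ _
  | succ n ih =>
    exact add_nonneg (M.meanReward_nonneg _ _)
      (Finset.sum_nonneg fun x _ => mul_nonneg (M.trans_nonneg _ _ _) (ih _ _))

theorem rollout_le (M : MDP S A) (n : ℕ) (g : ℕ → S → A) (s : S) :
    M.rollout n g s ≤ n + 1 := by
  induction n generalizing g s with
  | zero => simpa [rollout] using M.meanReward_le_one _ _
  | succ n ih =>
    have h : ∑ x, M.trans s (g 0 s) x * M.rollout n (fun j => g (j + 1)) x ≤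
        ∑ x, M.trans s (g 0 s) x * ((n : ℝ) + 1) :=
      Finset.sum_le_sum fun x _ => mul_le_mul_of_nonneg_left (ih _ _) (M.trans_nonneg _ _ _)
    rw [← Finset.sum_mul, sum_trans, one_mul] at h
    have := M.meanReward_le_one s (g 0 s)
    simp only [rollout]
    push_cast
    linarith

theorem measurable_rollout (n : ℕ) (g : ℕ → S → A) (s : S) :
    Measurable fun M : MDP S A => M.rollout n g s := by
  induction n generalizing g s with
  | zero => exact measurable_meanReward _ _
  | succ n ih =>
    exact (measurable_meanReward _ _).add
      (Finset.measurable_sum _ fun x _ => (measurable_trans _ _ _).mul (ih _ _))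

theorem sum_fin_succ_fun {n : ℕ} (F : (Fin (n + 1) → S) → ℝ) :
    ∑ y, F y = ∑ x, ∑ z : Fin n → S, F (Fin.cons x z) := by
  rw [← Fintype.sum_prod_type']
  exact (Fintype.sum_equiv (Fin.consEquiv fun _ => S) _ _ fun _ => rfl).symm

theorem sum_prod_trans (M : MDP S A) (n : ℕ) (g : ℕ → S → A) (s : S) :
    ∑ y : Fin n → S, ∏ j : Fin n,
      M.trans ((Fin.cons s y : Fin (n + 1) → S) j.castSucc)
        (g j ((Fin.cons s y : Fin (n + 1) → S) j.castSucc))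
        (y j) = 1 := by
  induction n generalizing g s with
  | zero => simp
  | succ n ih =>
    rw [sum_fin_succ_fun]
    simp only [Fin.prod_univ_succ, Fin.castSucc_zero, Fin.cons_zero, Fin.val_zero,
      Fin.cons_succ, Fin.val_succ, ← Fin.succ_castSucc]
    simp only [← Finset.mul_sum]
    simp only [ih (fun j => g (j + 1)), mul_one, sum_trans]

/-- Splitting off the first transition, the first reward is multiplied by the total mass of the
remaining paths, which is one by `sum_prod_trans`; the other rewards form the same sum for a path
shorter by one step. -/
theorem sum_path_eq_rollout (M : MDP S A) (n : ℕ) (g : ℕ → S → A) (s : S) :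
    ∑ y : Fin n → S, (∏ j : Fin n,
      M.trans ((Fin.cons s y : Fin (n + 1) → S) j.castSucc)
        (g j ((Fin.cons s y : Fin (n + 1) → S) j.castSucc))
        (y j)) *
      (∑ j : Fin (n + 1), M.meanReward ((Fin.cons s y : Fin (n + 1) → S) j)
        (g j ((Fin.cons s y : Fin (n + 1) → S) j))) = M.rollout n g s := by
  induction n generalizing g s with
  | zero => simp [rollout]
  | succ n ih =>
    rw [sum_fin_succ_fun]
    simp only [Fin.prod_univ_succ, Fin.castSucc_zero, Fin.cons_zero, Fin.val_zero,
      Fin.cons_succ, Fin.val_succ, ← Fin.succ_castSucc]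
    simp_rw [Fin.sum_univ_succ (n := n + 1)]
    simp only [Fin.cons_zero, Fin.val_zero, Fin.cons_succ, Fin.val_succ]
    simp only [mul_add, Finset.sum_add_distrib, mul_assoc]
    simp only [← Finset.mul_sum, ih (fun j => g (j + 1)), ← Finset.sum_mul,
      sum_prod_trans M n (fun j => g (j + 1)), one_mul, sum_trans, rollout]

/-- The decision rules of `μ` from step `i` on. -/
def Policy.from [NeZero τ] (μ : Policy S A τ) (i j : ℕ) (s : S) : A := μ s (Fin.ofNat τ (i + j))

theorem value_eq_rollout [NeZero τ] (M : MDP S A) (μ : Policy S A τ) (i : Fin τ) (s : S) :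
    M.value μ i s = M.rollout (τ - 1 - i) (Policy.from μ i) s := by
  rw [← sum_path_eq_rollout]
  -- `Fin.ofNat` reduces modulo `τ`, but the rollout stops at the end of the episode, so `i + j < τ`
  -- and nothing wraps around.
  have h : ∀ j : Fin (τ - 1 - i + 1), stepAdd i j = Fin.ofNat τ (i + j) := by
    intro j
    ext
    have := i.isLt
    have := j.isLt
    simp only [stepAdd, Fin.val_ofNat]
    exact (Nat.mod_eq_of_lt (by omega)).symm
  simp only [value, pathProb, h, Fin.cons_succ]
  rfl

theorem value_succ [NeZero τ] (M : MDP S A) (μ : Policy S A τ) (i : ℕ) (hi : i + 1 < τ) (s : S) :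
    M.value μ ⟨i, by omega⟩ s = M.meanReward s (μ s ⟨i, by omega⟩) +
      ∑ x, M.trans s (μ s ⟨i, by omega⟩) x * M.value μ ⟨i + 1, hi⟩ x := by
  simp only [value_eq_rollout]
  obtain ⟨n, hn⟩ : ∃ n, τ - 1 - i = n + 1 := ⟨τ - 1 - i - 1, by omega⟩
  have h0 : Policy.from μ i 0 = fun s => μ s ⟨i, by omega⟩ := by
    funext s
    simp only [Policy.from]
    congr 1
    ext
    simp [Nat.mod_eq_of_lt (show i < τ by omega)]
  have h1 : (fun j => Policy.from μ i (j + 1)) = Policy.from μ (i + 1) := by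
    funext j s
    simp only [Policy.from]
    rw [show i + (j + 1) = i + 1 + j by ring]
  rw [hn, show τ - 1 - (i + 1) = n by omega, rollout, h0, h1]

theorem value_last [NeZero τ] (M : MDP S A) (μ : Policy S A τ) (i : ℕ) (hi : i + 1 = τ) (s : S) :
    M.value μ ⟨i, by omega⟩ s = M.meanReward s (μ s ⟨i, by omega⟩) := by
  simp only [value_eq_rollout]
  rw [show τ - 1 - i = 0 by omega, rollout, Policy.from]
  congr 2
  ext
  simp [Nat.mod_eq_of_lt (show i < τ by omega)]

theorem value_nonneg [NeZero τ] (M : MDP S A) (μ : Policy S A τ) (i : Fin τ) (s : S) :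
    0 ≤ M.value μ i s := by
  rw [value_eq_rollout]
  exact M.rollout_nonneg _ _ _

theorem value_le [NeZero τ] (M : MDP S A) (μ : Policy S A τ) (i : Fin τ) (s : S) :
    M.value μ i s ≤ τ := by
  rw [value_eq_rollout]
  refine (M.rollout_le _ _ _).trans ?_
  have := i.isLt
  exact_mod_cast (show τ - 1 - i + 1 ≤ τ by omega)

theorem measurable_value [NeZero τ] (μ : Policy S A τ) (i : Fin τ) (s : S) :
    Measurable fun M : MDP S A => M.value μ i s := by
  simp only [value_eq_rollout]
  exact measurable_rollout _ _ _

theorem episodeRegret_nonneg [NeZero τ] (M : MDP S A) (μopt μ : Policy S A τ)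
    (h : M.IsOptimal μopt) : 0 ≤ M.episodeRegret μopt μ :=
  Finset.sum_nonneg fun s _ => mul_nonneg (M.init_nonneg s)
    (sub_nonneg.2 ((h s 0).2 ⟨μ, rfl⟩))

/-- The value of `μ` in `M` when the first state is drawn from the initial law of `M`. -/
def initValue [NeZero τ] (M : MDP S A) (μ : Policy S A τ) : ℝ := ∑ s, M.init s * M.value μ 0 s

theorem episodeRegret_eq [NeZero τ] (M : MDP S A) (μopt μ : Policy S A τ) :
    M.episodeRegret μopt μ = M.initValue μopt - M.initValue μ := by
  simp only [episodeRegret, initValue, mul_sub, Finset.sum_sub_distrib]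

theorem initValue_nonneg [NeZero τ] (M : MDP S A) (μ : Policy S A τ) : 0 ≤ M.initValue μ :=
  Finset.sum_nonneg fun s _ => mul_nonneg (M.init_nonneg s) (M.value_nonneg μ 0 s)

theorem initValue_le [NeZero τ] (M : MDP S A) (μ : Policy S A τ) : M.initValue μ ≤ τ := by
  refine (Finset.sum_le_sum fun s _ =>
    mul_le_mul_of_nonneg_left (M.value_le μ 0 s) (M.init_nonneg s)).trans ?_
  rw [← Finset.sum_mul, sum_init, one_mul]

theorem measurable_initValue [NeZero τ] (μ : Policy S A τ) :
    Measurable fun M : MDP S A => M.initValue μ :=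
  Finset.measurable_sum _ fun s _ => (measurable_init s).mul (measurable_value μ 0 s)

end MDP

/-! ### Pathwise estimates for the regularized empirical mean of one parameter. -/

namespace PSRL

theorem integrable_of_measurable_of_abs_le {Ω : Type*} [MeasurableSpace Ω] {P : Measure Ω}
    [IsFiniteMeasure P] {f : Ω → ℝ} (hf : Measurable f) (C : ℝ) (h : ∀ ω, |f ω| ≤ C) :
    Integrable f P :=
  Integrable.of_bound hf.aestronglyMeasurable C (ae_of_all _ h)

section Deterministic

variable (v x : ℕ → ℝ)

/-- The number of visits before time `t`, when `v u` is the indicator of a visit at time `u`. -/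
def visits (t : ℕ) : ℝ := ∑ u ∈ Finset.range t, v u

/-- The sum of the observations `x u` at the visits before time `t`. -/
def visitSum (t : ℕ) : ℝ := ∑ u ∈ Finset.range t, v u * x u

/-- The squared deviation from `c` of the regularized empirical mean of the observations before
time `t`, weighted by the number of visits plus one. -/
def sqDev (t : ℕ) (c : ℝ) : ℝ :=
  (visitSum v x t - (visits v t + 1) * c) ^ 2 / (visits v t + 1)

variable {v x}

theorem visits_succ (t : ℕ) : visits v (t + 1) = visits v t + v t := Finset.sum_range_succ _ _

theorem visitSum_succ (t : ℕ) : visitSum v x (t + 1) = visitSum v x t + v t * x t :=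
  Finset.sum_range_succ _ _

variable (hv : ∀ t, v t = 0 ∨ v t = 1)
include hv

theorem visit_nonneg (t : ℕ) : 0 ≤ v t := by
  rcases hv t with h | h <;> simp [h]

theorem visit_le_one (t : ℕ) : v t ≤ 1 := by
  rcases hv t with h | h <;> simp [h]

theorem visits_nonneg (t : ℕ) : 0 ≤ visits v t :=
  Finset.sum_nonneg fun u _ => visit_nonneg hv u

theorem visits_add_le (t i : ℕ) : visits v (t + i) ≤ visits v t + i := by
  induction i with
  | zero => simp
  | succ i ih =>
    rw [← add_assoc, visits_succ]
    push_cast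
    linarith [visit_le_one hv (t + i)]

theorem visits_le (t : ℕ) : visits v t ≤ t := by
  simpa [visits] using visits_add_le hv 0 t

/-- Only visits contribute, which makes this a harmonic sum: `1 / (N + 1) ≤ 2 / (N + 2) ≤ 2 * (log
(N + 2) - log (N + 1))`, and the logarithms telescope. -/
theorem sum_visit_div_le (t : ℕ) :
    ∑ u ∈ Finset.range t, v u / (visits v u + 1) ≤ 2 * Real.log (visits v t + 1) := by
  induction t with
  | zero => simp [visits]
  | succ t ih =>
    rw [Finset.sum_range_succ, visits_succ]
    rcases hv t with h | h
    · simpa [h] using ih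
    · have h0 := visits_nonneg hv t
      set N := visits v t
      have h1 : 1 / (N + 2) ≤ Real.log (N + 2) - Real.log (N + 1) := by
        rw [← Real.log_div (by positivity) (by positivity)]
        have := Real.one_sub_inv_le_log_of_pos (show 0 < (N + 2) / (N + 1) by positivity)
        refine le_trans (le_of_eq ?_) this
        field_simp
        ring
      have h2 : 1 / (N + 1) ≤ 2 * (1 / (N + 2)) := by
        rw [mul_one_div, div_le_div_iff₀ (by positivity) (by positivity)]
        linarith
      rw [h, show N + 1 + 1 = N + 2 by ring]
      linarith

theorem sum_visit_div_le_log {t n : ℕ} (h : t ≤ n) :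
    ∑ u ∈ Finset.range t, v u / (visits v u + 1) ≤ 2 * Real.log (n + 1) := by
  refine (sum_visit_div_le hv t).trans ?_
  have h0 := visits_nonneg hv t
  have h1 := visits_le hv t
  have h2 : (t : ℝ) ≤ n := by exact_mod_cast h
  have := Real.log_le_log (show 0 < visits v t + 1 by linarith)
    (show visits v t + 1 ≤ n + 1 by linarith)
  linarith

theorem sqDev_nonneg (t : ℕ) (c : ℝ) : 0 ≤ sqDev v x t c :=
  div_nonneg (sq_nonneg _) (by linarith [visits_nonneg hv t])

/-- `(visits v t + 1) * (d - c)` is the difference of the two deviations from the common empirical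
sum, and `(p - q)^2 ≤ 2 * (p^2 + q^2)`. -/
theorem mul_sq_le_sqDev (t : ℕ) (c d : ℝ) :
    (visits v t + 1) * (d - c) ^ 2 ≤ 2 * (sqDev v x t d + sqDev v x t c) := by
  have h0 := visits_nonneg hv t
  simp only [sqDev]
  rw [← add_div, ← mul_div_assoc, le_div_iff₀ (by linarith)]
  nlinarith [sq_nonneg ((visitSum v x t - (visits v t + 1) * d) +
    (visitSum v x t - (visits v t + 1) * c))]

/-- Here `k` is the first time of the episode of `t`. Posterior sampling controls the deviations
only there, while the visit count must be taken at `t` for the harmonic sum; within an episode the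
two counts are comparable. -/
theorem visit_mul_abs_le {τ k t : ℕ} (hk : k ≤ t) (ht : t < k + τ) {b : ℝ} (hb : 0 < b) (c d : ℝ) :
    v t * |d - c| ≤ b / 2 * τ * (v t / (visits v t + 1)) +
      1 / b * (sqDev v x k d + sqDev v x k c) := by
  have h0 := visits_nonneg hv k
  have h0' := visits_nonneg hv t
  have h1 := mul_sq_le_sqDev (x := x) hv k c d
  have h2 := sqDev_nonneg (x := x) hv k d
  have h3 := sqDev_nonneg (x := x) hv k c
  rcases hv t with h | h
  · rw [h]
    have : 0 ≤ 1 / b * (sqDev v x k d + sqDev v x k c) := by positivity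
    simpa using this
  · rw [h, one_mul]
    -- Fewer than `τ` steps have passed since `k`, so the left side is at most `visits v k + τ`.
    have hτ : visits v t + 1 ≤ τ * (visits v k + 1) := by
      obtain ⟨i, rfl⟩ := Nat.exists_eq_add_of_le hk
      have h4 := visits_add_le hv k i
      have h5 : (i : ℝ) + 1 ≤ τ := by exact_mod_cast (show i + 1 ≤ τ by omega)
      nlinarith
    set m := visits v k + 1
    have hm : 0 < m := by positivity
    have h6 : 1 / m ≤ τ * (1 / (visits v t + 1)) := by
      rw [mul_one_div, div_le_div_iff₀ hm (by positivity)]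
      linarith
    -- Arithmetic-geometric mean inequality; the difference of the two sides is a perfect square
    -- over `2 * b * m`.
    have h7 : |d - c| ≤ b / 2 * (1 / m) + 1 / (2 * b) * (m * (d - c) ^ 2) := by
      have h8 : b / 2 * (1 / m) + 1 / (2 * b) * (m * (d - c) ^ 2) - |d - c| =
          (b - m * |d - c|) ^ 2 / (2 * b * m) := by
        rw [← sq_abs (d - c)]
        field_simp
        ring
      have : 0 ≤ (b - m * |d - c|) ^ 2 / (2 * b * m) := by positivity
      linarith
    have h9 : 1 / (2 * b) * (m * (d - c) ^ 2) ≤ 1 / b * (sqDev v x k d + sqDev v x k c) := by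
      have := mul_le_mul_of_nonneg_left h1 (show 0 ≤ 1 / (2 * b) by positivity)
      refine this.trans (le_of_eq ?_)
      field_simp
    have h10 := mul_le_mul_of_nonneg_left h6 (show 0 ≤ b / 2 by positivity)
    linarith

variable (hx : ∀ t, x t ∈ Set.Icc (0 : ℝ) 1)
include hx

theorem visitSum_mem (t : ℕ) : visitSum v x t ∈ Set.Icc 0 (visits v t) :=
  ⟨Finset.sum_nonneg fun u _ => mul_nonneg (visit_nonneg hv u) (hx u).1,
    Finset.sum_le_sum fun u _ => mul_le_of_le_one_right (visit_nonneg hv u) (hx u).2⟩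

theorem abs_visitSum_sub_le (t : ℕ) {c : ℝ} (hc : c ∈ Set.Icc (0 : ℝ) 1) :
    |visitSum v x t - (visits v t + 1) * c| ≤ visits v t + 1 := by
  have h0 := visits_nonneg hv t
  have h1 := visitSum_mem hv hx t
  rw [abs_le]
  constructor <;> nlinarith [h1.1, h1.2, hc.1, hc.2]

theorem sqDev_le (t : ℕ) {c : ℝ} (hc : c ∈ Set.Icc (0 : ℝ) 1) : sqDev v x t c ≤ t + 1 := by
  have h0 := visits_nonneg hv t
  have h1 := visits_le hv t
  have h2 := abs_le.1 (abs_visitSum_sub_le hv hx t hc)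
  refine le_trans ?_ (add_le_add_left h1 1)
  rw [sqDev, div_le_iff₀ (by linarith)]
  nlinarith [h2.1, h2.2]

theorem abs_weight_le (t : ℕ) {c : ℝ} (hc : c ∈ Set.Icc (0 : ℝ) 1) :
    |(visitSum v x t - (visits v t + 1) * c) / (visits v t + 2)| ≤ 1 := by
  have h0 := visits_nonneg hv t
  rw [abs_div, abs_of_pos (show 0 < visits v t + 2 by linarith), div_le_one (by linarith)]
  linarith [abs_visitSum_sub_le hv hx t hc]

/-- At a visit the numerator `D` becomes `D + (x t - c)`, because the regularizing `+ 1` is present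
both before and after. Expanding the square leaves a cross term whose weight is determined before `x
t` is observed, and a squared noise of size at most one. -/
theorem sqDev_succ_le (t : ℕ) {c : ℝ} (hc : c ∈ Set.Icc (0 : ℝ) 1) :
    sqDev v x (t + 1) c ≤ sqDev v x t c +
      2 * ((visitSum v x t - (visits v t + 1) * c) / (visits v t + 2) * (v t * (x t - c))) +
      v t / (visits v t + 1) := by
  have h0 := visits_nonneg hv t
  simp only [sqDev, visits_succ, visitSum_succ]
  rcases hv t with h | h
  · simp [h]
  · rw [h]
    set N := visits v t
    set D := visitSum v x t - (N + 1) * c with hD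
    have hξ : (x t - c) ^ 2 ≤ 1 := by
      have := hx t
      nlinarith [this.1, this.2, hc.1, hc.2]
    have e1 : visitSum v x t + 1 * x t - (N + 1 + 1) * c = D + (x t - c) := by
      rw [hD]; ring
    have e2 : (D + (x t - c)) ^ 2 / (N + 1 + 1) = D ^ 2 / (N + 2) +
        2 * (D / (N + 2) * (1 * (x t - c))) + (x t - c) ^ 2 / (N + 2) := by
      rw [show N + 1 + 1 = N + 2 by ring]
      field_simp
      ring
    rw [e1, e2]
    have h1 : D ^ 2 / (N + 2) ≤ D ^ 2 / (N + 1) := by gcongr; norm_num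
    have h2 : (x t - c) ^ 2 / (N + 2) ≤ 1 / (N + 1) := by gcongr; norm_num
    linarith

end Deterministic

/-! ### Expected deviations: logarithmic second moment and the resulting square-root bound. -/

section Expectation

variable {Ω : Type*} [MeasurableSpace Ω] {P : Measure Ω} [IsProbabilityMeasure P]
  {v x : ℕ → Ω → ℝ} {c : Ω → ℝ}

omit [MeasurableSpace Ω] in
theorem measurable_visits {m : MeasurableSpace Ω} {t : ℕ} (hvm : ∀ u < t, Measurable[m] (v u)) :
    Measurable[m] fun ω => visits (fun u => v u ω) t :=
  Finset.measurable_sum _ fun u hu => hvm u (Finset.mem_range.1 hu)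

omit [MeasurableSpace Ω] in
theorem measurable_visitSum {m : MeasurableSpace Ω} {t : ℕ}
    (hxm : ∀ u < t, Measurable[m] fun ω => v u ω * x u ω) :
    Measurable[m] fun ω => visitSum (fun u => v u ω) (fun u => x u ω) t :=
  Finset.measurable_sum _ fun u hu => hxm u (Finset.mem_range.1 hu)

theorem measurable_sqDev (hvm : ∀ t, Measurable (v t)) (hxm : ∀ t, Measurable (x t))
    (hcm : Measurable c) (t : ℕ) :
    Measurable fun ω => sqDev (fun u => v u ω) (fun u => x u ω) t (c ω) := by
  have h1 := measurable_visits (t := t) fun u _ => hvm u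
  have h2 := measurable_visitSum (t := t) fun u _ => (hvm u).mul (hxm u)
  exact ((h2.sub ((h1.add_const 1).mul hcm)).pow_const 2).div (h1.add_const 1)

variable (hvm : ∀ t, Measurable (v t)) (hxm : ∀ t, Measurable (x t))
  (hv : ∀ t ω, v t ω = 0 ∨ v t ω = 1) (hx : ∀ t ω, x t ω ∈ Set.Icc (0 : ℝ) 1)

include hvm hv in
theorem integrable_visit_div (t : ℕ) :
    Integrable (fun ω => v t ω / (visits (fun u => v u ω) t + 1)) P := by
  refine integrable_of_measurable_of_abs_le
    ((hvm t).div ((measurable_visits fun u _ => hvm u).add_const 1)) 1 fun ω => ?_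
  have h0 := visits_nonneg (hv · ω) t
  have h1 := visit_nonneg (hv · ω) t
  have h2 := visit_le_one (hv · ω) t
  rw [abs_of_nonneg (by positivity), div_le_one (by positivity)]
  linarith

include hvm hxm hv hx in
theorem integrable_sqDev (hcm : Measurable c) (hc : ∀ ω, c ω ∈ Set.Icc (0 : ℝ) 1) (t : ℕ) :
    Integrable (fun ω => sqDev (fun u => v u ω) (fun u => x u ω) t (c ω)) P := by
  refine integrable_of_measurable_of_abs_le (measurable_sqDev hvm hxm hcm t) (t + 1) fun ω => ?_
  rw [abs_of_nonneg (sqDev_nonneg (hv · ω) t _)]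
  exact sqDev_le (hv · ω) (hx · ω) t (hc ω)

variable (hcm : Measurable c) (hc : ∀ ω, c ω ∈ Set.Icc (0 : ℝ) 1)
  (hnoise : ∀ t, ∫ ω, (visitSum (fun u => v u ω) (fun u => x u ω) t -
    (visits (fun u => v u ω) t + 1) * c ω) / (visits (fun u => v u ω) t + 2) *
      (v t ω * (x t ω - c ω)) ∂P = 0)
include hvm hxm hv hx hcm hc hnoise

/-- Integrating `sqDev_succ_le` removes the cross term by `hnoise`. The initial `1` bounds the
regularization error `c^2` before any visit. -/
theorem integral_sqDev_le_sum (t : ℕ) :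
    ∫ ω, sqDev (fun u => v u ω) (fun u => x u ω) t (c ω) ∂P ≤
      1 + ∑ u ∈ Finset.range t, ∫ ω, v u ω / (visits (fun u => v u ω) u + 1) ∂P := by
  induction t with
  | zero =>
    have h : ∫ ω, sqDev (fun u => v u ω) (fun u => x u ω) 0 (c ω) ∂P ≤ ∫ _, (1 : ℝ) ∂P := by
      refine integral_mono (integrable_sqDev hvm hxm hv hx hcm hc 0) (integrable_const _)
        fun ω => ?_
      simpa using sqDev_le (hv · ω) (hx · ω) 0 (hc ω)
    simpa using h
  | succ t ih =>
    rw [Finset.sum_range_succ]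
    have hw : Integrable (fun ω => (visitSum (fun u => v u ω) (fun u => x u ω) t -
        (visits (fun u => v u ω) t + 1) * c ω) / (visits (fun u => v u ω) t + 2) *
          (v t ω * (x t ω - c ω))) P := by
      have h1 := measurable_visits (t := t) fun u _ => hvm u
      have h2 := measurable_visitSum (t := t) fun u _ => (hvm u).mul (hxm u)
      refine integrable_of_measurable_of_abs_le
        (((h2.sub ((h1.add_const 1).mul hcm)).div (h1.add_const 2)).mul
          ((hvm t).mul ((hxm t).sub hcm))) 1 fun ω => ?_
      rw [abs_mul]
      refine mul_le_one₀ (abs_weight_le (hv · ω) (hx · ω) t (hc ω)) (abs_nonneg _) ?_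
      rw [abs_mul, abs_of_nonneg (visit_nonneg (hv · ω) t)]
      refine mul_le_one₀ (visit_le_one (hv · ω) t) (abs_nonneg _) ?_
      have h3 := hx t ω
      have h4 := hc ω
      rw [abs_le]
      constructor <;> linarith [h3.1, h3.2, h4.1, h4.2]
    have hZ := integrable_sqDev (P := P) hvm hxm hv hx hcm hc
    have hd := integrable_visit_div (P := P) hvm hv t
    have h : ∫ ω, sqDev (fun u => v u ω) (fun u => x u ω) (t + 1) (c ω) ∂P ≤ _ :=
      integral_mono (hZ (t + 1)) (((hZ t).add (hw.const_mul 2)).add hd)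
        fun ω => sqDev_succ_le (hv · ω) (hx · ω) t (hc ω)
    rw [integral_add' ((hZ t).add (hw.const_mul 2)) hd, integral_add' (hZ t) (hw.const_mul 2),
      integral_const_mul, hnoise t] at h
    linarith

theorem integral_sqDev_le {t n : ℕ} (h : t ≤ n) :
    ∫ ω, sqDev (fun u => v u ω) (fun u => x u ω) t (c ω) ∂P ≤ 1 + 2 * Real.log (n + 1) := by
  refine (integral_sqDev_le_sum hvm hxm hv hx hcm hc hnoise t).trans ?_
  rw [← integral_finsetSum _ fun u _ => integrable_visit_div hvm hv u]
  have h1 : ∫ ω, ∑ u ∈ Finset.range t, v u ω / (visits (fun u => v u ω) u + 1) ∂P ≤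
      ∫ _, 2 * Real.log ((n : ℝ) + 1) ∂P :=
    integral_mono (integrable_finsetSum _ fun u _ => integrable_visit_div hvm hv u)
      (integrable_const _) fun ω => sum_visit_div_le_log (hv · ω) h
  simp only [integral_const, probReal_univ, one_smul] at h1
  linarith

/-- If the weighted squared deviation of the empirical means at the start of an episode has the same
expectation from the sampled parameter `d k` as from the true parameter `c`, then the deviations of
the sampled parameters from the true one at the visits before time `K τ` are of order `√(K τ)` up to
a logarithm. -/
theorem sum_integral_visit_mul_abs_le {τ : ℕ} [NeZero τ] {d : ℕ → Ω → ℝ}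
    (hdm : ∀ k, Measurable (d k)) (hd : ∀ k ω, d k ω ∈ Set.Icc (0 : ℝ) 1)
    (hpost : ∀ k, ∫ ω, sqDev (fun u => v u ω) (fun u => x u ω) (k * τ) (d k ω) ∂P =
      ∫ ω, sqDev (fun u => v u ω) (fun u => x u ω) (k * τ) (c ω) ∂P) (n : ℕ) :
    ∑ t ∈ Finset.range n, ∫ ω, v t ω * |d (t / τ) ω - c ω| ∂P ≤
      (τ + 2) * (√n * (1 + 2 * Real.log (n + 1))) := by
  rcases Nat.eq_zero_or_pos n with rfl | hn
  · simp
  have hb : 0 < √(n : ℝ) := Real.sqrt_pos.2 (by exact_mod_cast hn)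
  -- This choice balances the two contributions, `b * log n` from the harmonic sum and `n * log n /
  -- b` from the `n` squared deviations.
  set b := √(n : ℝ) with hbdef
  set L := 2 * Real.log ((n : ℝ) + 1) with hL
  have hL0 : 0 ≤ L := mul_nonneg two_pos.le (Real.log_nonneg (by linarith [Nat.cast_nonneg (α := ℝ) n]))
  have key : ∀ t ∈ Finset.range n, ∫ ω, v t ω * |d (t / τ) ω - c ω| ∂P ≤
      b / 2 * τ * ∫ ω, v t ω / (visits (fun u => v u ω) t + 1) ∂P + 1 / b * (2 * (1 + L)) := by
    intro t ht
    have hk : t / τ * τ ≤ t := Nat.div_mul_le_self t τ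
    have ht' : t < t / τ * τ + τ := Nat.lt_div_mul_add (NeZero.pos τ)
    have hc' := integrable_sqDev (P := P) hvm hxm hv hx hcm hc (t / τ * τ)
    have hd' := integrable_sqDev (P := P) hvm hxm hv hx (hdm (t / τ)) (hd (t / τ)) (t / τ * τ)
    have hi := integrable_visit_div (P := P) hvm hv t
    have h1 : ∫ ω, v t ω * |d (t / τ) ω - c ω| ∂P ≤ _ :=
      integral_mono_of_nonneg
        (ae_of_all _ fun ω => mul_nonneg (visit_nonneg (hv · ω) t) (abs_nonneg _))
        ((hi.const_mul (b / 2 * τ)).add ((hd'.add hc').const_mul (1 / b)))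
        (ae_of_all _ fun ω => visit_mul_abs_le (x := fun u => x u ω) (hv · ω) hk ht' hb (c ω)
          (d (t / τ) ω))
    refine h1.trans ?_
    rw [integral_add' (hi.const_mul _) ((hd'.add hc').const_mul _), integral_const_mul,
      integral_const_mul, integral_add' hd' hc', hpost]
    have h2 := integral_sqDev_le hvm hxm hv hx hcm hc hnoise
      (hk.trans (Finset.mem_range.1 ht).le)
    have h3 := mul_le_mul_of_nonneg_left h2 (show 0 ≤ 2 * (1 / b) by positivity)
    linarith
  refine (Finset.sum_le_sum key).trans ?_
  rw [Finset.sum_add_distrib, ← Finset.mul_sum, Finset.sum_const, Finset.card_range, nsmul_eq_mul,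
    ← integral_finsetSum _ fun u _ => integrable_visit_div hvm hv u]
  have h1 : ∫ ω, ∑ u ∈ Finset.range n, v u ω / (visits (fun u => v u ω) u + 1) ∂P ≤
      ∫ _, L ∂P :=
    integral_mono (integrable_finsetSum _ fun u _ => integrable_visit_div hvm hv u)
      (integrable_const _) fun ω => sum_visit_div_le_log (hv · ω) le_rfl
  simp only [integral_const, probReal_univ, one_smul] at h1
  have h2 : (n : ℝ) * (1 / b * (2 * (1 + L))) = b * (2 * (1 + L)) := by
    have : (n : ℝ) = b * b := (Real.mul_self_sqrt (Nat.cast_nonneg n)).symm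
    rw [this]
    field_simp
  rw [h2]
  have h3 := mul_le_mul_of_nonneg_left h1 (show 0 ≤ b / 2 * τ by positivity)
  have h4 : 0 ≤ b * τ * (1 + L / 2) := by positivity
  linarith

end Expectation

end PSRL

/-! ### Conditional laws, conditional means and centred noise. -/

namespace PSRL

section CondExp

variable {Ω : Type*} {m : MeasurableSpace Ω} [mΩ : MeasurableSpace Ω] {P : Measure Ω}
  [IsProbabilityMeasure P]

theorem integral_mul_of_condExp_ae_eq (hm : m ≤ mΩ) {x g y : Ω → ℝ} (hx : Integrable x P)
    (h : P[x | m] =ᵐ[P] g) (hy : Measurable[m] y) (C : ℝ) (hC : ∀ ω, |y ω| ≤ C) :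
    ∫ ω, y ω * x ω ∂P = ∫ ω, y ω * g ω ∂P := by
  have hyx : Integrable (y * x) P :=
    hx.bdd_mul (hy.mono hm le_rfl).aestronglyMeasurable (ae_of_all _ hC)
  have h1 := condExp_mul_of_stronglyMeasurable_left hy.stronglyMeasurable hyx hx
  calc ∫ ω, y ω * x ω ∂P = ∫ ω, (P[y * x | m]) ω ∂P := (integral_condExp hm).symm
    _ = ∫ ω, y ω * g ω ∂P := integral_congr_ae (by
        filter_upwards [h1, h] with ω h1 h
        rw [h1, Pi.mul_apply, h])

/-- If `κ` is a conditional law of `X` given `m`, then `∫ f dκ` is a conditional expectation of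
`f ∘ X`. -/
theorem condExp_comp_ae_eq {β : Type*} [MeasurableSpace β] (hm : m ≤ mΩ) {X : Ω → β}
    (hX : Measurable X) {κ : Ω → Measure β} [∀ ω, IsProbabilityMeasure (κ ω)]
    (hκ : Measurable[m] κ)
    (h : ∀ B, MeasurableSet B → P⟦X ⁻¹' B | m⟧ =ᵐ[P] fun ω => (κ ω).real B)
    {f : β → ℝ} (hf : Measurable f) {C : ℝ} (h0 : ∀ b, 0 ≤ f b) (hC : ∀ b, f b ≤ C) :
    P[fun ω => f (X ω) | m] =ᵐ[P] fun ω => ∫ b, f b ∂κ ω := by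
  have hκ' : Measurable κ := hκ.mono hm le_rfl
  have hfi : ∀ ω, Integrable f (κ ω) := fun ω => integrable_of_measurable_of_abs_le hf C
    fun b => by rw [abs_of_nonneg (h0 b)]; exact hC b
  have hofReal : ∀ ω, ENNReal.ofReal (∫ b, f b ∂κ ω) = ∫⁻ b, ENNReal.ofReal (f b) ∂κ ω :=
    fun ω => ofReal_integral_eq_lintegral_ofReal (hfi ω) (ae_of_all _ h0)
  have hgm : Measurable[m] fun ω => ∫ b, f b ∂κ ω := by
    have : (fun ω => ∫ b, f b ∂κ ω) = fun ω => (∫⁻ b, ENNReal.ofReal (f b) ∂κ ω).toReal := by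
      funext ω
      rw [← hofReal, ENNReal.toReal_ofReal (integral_nonneg h0)]
    rw [this]
    exact ((Measure.measurable_lintegral hf.ennreal_ofReal).comp hκ).ennreal_toReal
  have hgb : ∀ ω, |∫ b, f b ∂κ ω| ≤ C := fun ω => by
    rw [abs_of_nonneg (integral_nonneg h0)]
    have := integral_mono (hfi ω) (integrable_const C) hC
    simpa using this
  have hxi : Integrable (fun ω => f (X ω)) P := integrable_of_measurable_of_abs_le (hf.comp hX) C
    fun ω => by rw [abs_of_nonneg (h0 _)]; exact hC _
  refine (ae_eq_condExp_of_forall_setIntegral_eq hm hxi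
    (fun _ _ _ => (integrable_of_measurable_of_abs_le (hgm.mono hm le_rfl) C hgb).integrableOn)
    (fun D hD _ => ?_) hgm.stronglyMeasurable.aestronglyMeasurable).symm
  -- On each event `D` of `m`, the law of `X` is the mixture of the `κ ω`: this is `h` integrated
  -- over `D`. It extends the hypothesis from sets `B` to functions `f`.
  have hbind : (P.restrict D).map X = (P.restrict D).bind κ := by
    ext B hB
    rw [Measure.map_apply hX hB, Measure.restrict_apply (hX hB),
      Measure.bind_apply hB hκ'.aemeasurable]
    have h1 := setIntegral_condExp hm (μ := P) (f := (X ⁻¹' B).indicator fun _ => (1 : ℝ))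
      ((integrable_const _).indicator (hX hB)) hD
    rw [setIntegral_congr_ae (hm _ hD) ((h B hB).mono fun ω hω _ => hω),
      integral_indicator (hX hB), Measure.restrict_restrict (hX hB)] at h1
    have h2 : ∫⁻ ω in D, κ ω B ∂P = ENNReal.ofReal (∫ ω in D, (κ ω).real B ∂P) := by
      have hb : Measurable fun ω => (κ ω).real B :=
        ((Measure.measurable_coe hB).comp hκ').ennreal_toReal
      rw [ofReal_integral_eq_lintegral_ofReal
        (integrable_of_measurable_of_abs_le hb 1 fun ω => by
          rw [abs_of_nonneg measureReal_nonneg]; exact measureReal_le_one)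
        (ae_of_all _ fun ω => measureReal_nonneg)]
      simp
    rw [h2, h1]
    simp
  rw [integral_eq_lintegral_of_nonneg_ae (ae_of_all _ fun ω => integral_nonneg h0)
      (hgm.mono hm le_rfl).aestronglyMeasurable,
    integral_eq_lintegral_of_nonneg_ae (ae_of_all _ fun ω => h0 _)
      (hf.comp hX).aestronglyMeasurable]
  simp_rw [hofReal]
  rw [← lintegral_map (f := fun b => ENNReal.ofReal (f b)) hf.ennreal_ofReal hX, hbind,
    Measure.lintegral_bind hκ'.aemeasurable hf.ennreal_ofReal.aemeasurable]

/-- The weighted noise at a visit vanishes in expectation when, given a σ-algebra that contains the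
past, the conditional expectation of the observation is the true parameter. -/
theorem integral_noise_eq_zero (hm : m ≤ mΩ) {v x : ℕ → Ω → ℝ} {c g : Ω → ℝ} {t : ℕ}
    (hv : ∀ t ω, v t ω = 0 ∨ v t ω = 1) (hx : ∀ t ω, x t ω ∈ Set.Icc (0 : ℝ) 1)
    (hc : ∀ ω, c ω ∈ Set.Icc (0 : ℝ) 1) (hxm : Measurable (x t))
    (hvm : ∀ u ≤ t, Measurable[m] (v u)) (hvx : ∀ u < t, Measurable[m] fun ω => v u ω * x u ω)
    (hcm : Measurable[m] c) (h : P[x t | m] =ᵐ[P] g) (hg : ∀ ω, v t ω * g ω = v t ω * c ω) :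
    ∫ ω, (visitSum (fun u => v u ω) (fun u => x u ω) t -
      (visits (fun u => v u ω) t + 1) * c ω) / (visits (fun u => v u ω) t + 2) *
        (v t ω * (x t ω - c ω)) ∂P = 0 := by
  -- The weight includes the visit indicator, so it is `m`-measurable and bounded, and `g` needs to
  -- agree with `c` only at visits.
  set w : Ω → ℝ := fun ω => (visitSum (fun u => v u ω) (fun u => x u ω) t -
      (visits (fun u => v u ω) t + 1) * c ω) / (visits (fun u => v u ω) t + 2) * v t ω with hw
  have hwm : Measurable[m] w := by
    have h1 := measurable_visits fun u hu => hvm u (le_of_lt hu)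
    have h2 := measurable_visitSum hvx
    exact ((h2.sub ((h1.add_const 1).mul hcm)).div (h1.add_const 2)).mul (hvm t le_rfl)
  have hwb : ∀ ω, |w ω| ≤ 1 := fun ω => by
    rw [hw, abs_mul, abs_of_nonneg (visit_nonneg (hv · ω) t)]
    exact mul_le_one₀ (abs_weight_le (hv · ω) (hx · ω) t (hc ω)) (visit_nonneg (hv · ω) t)
      (visit_le_one (hv · ω) t)
  have hi : ∀ {z : Ω → ℝ}, Measurable z → (∀ ω, z ω ∈ Set.Icc (0 : ℝ) 1) → Integrable z P :=
    fun hz h => integrable_of_measurable_of_abs_le hz 1 fun ω => by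
      rw [abs_of_nonneg (h ω).1]; exact (h ω).2
  have hwi : ∀ {z : Ω → ℝ}, Measurable z → (∀ ω, z ω ∈ Set.Icc (0 : ℝ) 1) →
      Integrable (fun ω => w ω * z ω) P := fun hz h =>
    (hi hz h).bdd_mul (hwm.mono hm le_rfl).aestronglyMeasurable (ae_of_all _ hwb)
  have h1 := integral_mul_of_condExp_ae_eq hm (hi hxm (hx t)) h hwm 1 hwb
  have h2 : ∫ ω, w ω * g ω ∂P = ∫ ω, w ω * c ω ∂P := integral_congr_ae (ae_of_all _ fun ω => by
    simp only [hw, mul_assoc, hg])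
  have h3 : ∀ ω, (visitSum (fun u => v u ω) (fun u => x u ω) t -
      (visits (fun u => v u ω) t + 1) * c ω) / (visits (fun u => v u ω) t + 2) *
        (v t ω * (x t ω - c ω)) = w ω * x t ω - w ω * c ω := fun ω => by
    simp only [hw]; ring
  simp_rw [h3]
  rw [integral_sub (hwi hxm (hx t)) (hwi (hcm.mono hm le_rfl) hc), h1, h2, sub_self]

end CondExp

end PSRL

/-! ### Joint measurability in the MDP, the policy, the state and the action. -/

namespace MDP

variable {S A : Type*} [Fintype S] [Fintype A] {τ : ℕ} [NeZero τ]
  [MeasurableSpace S] [DiscreteMeasurableSpace S] [MeasurableSpace A] [DiscreteMeasurableSpace A]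

omit [MeasurableSpace S] [DiscreteMeasurableSpace S] in
-- There are finitely many policies, so measurability in the MDP for each fixed policy suffices.
theorem measurable_value_prod (i : Fin τ) (x : S) :
    Measurable fun p : MDP S A × Policy S A τ => p.1.value p.2 i x :=
  measurable_from_prod_countable_left fun μ => measurable_value μ i x

theorem measurable_value_uncurry (i : Fin τ) :
    Measurable fun p : (MDP S A × Policy S A τ) × S => p.1.1.value p.1.2 i p.2 :=
  measurable_from_prod_countable_left fun x => measurable_value_prod i x

omit [MeasurableSpace S] [DiscreteMeasurableSpace S] in
theorem measurable_initValue_uncurry :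
    Measurable fun p : MDP S A × Policy S A τ => p.1.initValue p.2 :=
  measurable_from_prod_countable_left fun μ => measurable_initValue μ

theorem measurable_reward_uncurry :
    Measurable fun p : MDP S A × S × A =>
      (p.1.reward p.2.1 p.2.2 : Measure (Set.Icc (0 : ℝ) 1)) :=
  measurable_from_prod_countable_left fun q => measurable_reward q.1 q.2

end MDP

/-! ### Information σ-algebras and the exchange of sampled and true MDP. -/

namespace PSRL

theorem indicator_one_eq {Ω : Type*} (B : Set Ω) (ω : Ω) :
    B.indicator (fun _ => (1 : ℝ)) ω = 0 ∨ B.indicator (fun _ => (1 : ℝ)) ω = 1 := by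
  by_cases h : ω ∈ B <;> simp [h]

theorem indicator_one_mem {Ω : Type*} (B : Set Ω) (ω : Ω) :
    B.indicator (fun _ => (1 : ℝ)) ω ∈ Set.Icc (0 : ℝ) 1 := by
  by_cases h : ω ∈ B <;> simp [h]

variable {S A Ω : Type*} [Fintype S] {τ : ℕ} [NeZero τ]
  [MeasurableSpace S] [DiscreteMeasurableSpace S] [MeasurableSpace A] [DiscreteMeasurableSpace A]
  {polOf : MDP S A → Policy S A τ} {Mstar : Ω → MDP S A} {M : ℕ → Ω → MDP S A}
  {s : ℕ → Ω → S} {r : ℕ → Ω → Set.Icc (0 : ℝ) 1}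

/-- The σ-algebra generated by the history before time `t`. -/
abbrev past (polOf : MDP S A → Policy S A τ) (M : ℕ → Ω → MDP S A) (s : ℕ → Ω → S)
    (r : ℕ → Ω → Set.Icc (0 : ℝ) 1) (t : ℕ) : MeasurableSpace Ω :=
  MeasurableSpace.comap (history polOf M s r t) inferInstance

/-- The event that the state at time `t` is `y` and the action is `a`. -/
def visitSet (polOf : MDP S A → Policy S A τ) (M : ℕ → Ω → MDP S A) (s : ℕ → Ω → S) (y : S) (a : A)
    (t : ℕ) : Set Ω :=
  {ω | s t ω = y ∧ action polOf M s t ω = a}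

section Sigma

omit [DiscreteMeasurableSpace S] [DiscreteMeasurableSpace A]

theorem measurable_history_component {t j : ℕ} (h : j < t) :
    Measurable[past polOf M s r t] fun ω => (s j ω, action polOf M s j ω, r j ω) :=
  (measurable_pi_apply (⟨j, h⟩ : Fin t)).comp
    (comap_measurable (m := inferInstance) (history polOf M s r t))

theorem past_le_info (n t : ℕ) : past polOf M s r t ≤ info polOf Mstar M s r n t :=
  Measurable.comap_le (measurable_snd.snd.comp (comap_measurable _))

theorem measurable_true_info (n t : ℕ) : Measurable[info polOf Mstar M s r n t] Mstar :=
  measurable_fst.comp (comap_measurable (m := inferInstance)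
    (fun ω => (Mstar ω, (fun j : Fin n => M j ω), history polOf M s r t ω)))

theorem measurable_sample_info {n k : ℕ} (h : k < n) (t : ℕ) :
    Measurable[info polOf Mstar M s r n t] (M k) :=
  (measurable_pi_apply (⟨k, h⟩ : Fin n)).comp (measurable_snd.fst.comp
    (comap_measurable (m := inferInstance)
      (fun ω => (Mstar ω, (fun j : Fin n => M j ω), history polOf M s r t ω))))

end Sigma

variable [Fintype A]

theorem measurable_action {m : MeasurableSpace Ω} (hmeas : Measurable polOf) {t : ℕ}
    (hM : Measurable[m] (M (t / τ))) (hs : Measurable[m] (s t)) :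
    Measurable[m] (action polOf M s t) :=
  (measurable_of_countable fun p : Policy S A τ × S => p.1 p.2 (Fin.ofNat τ t)).comp
    ((hmeas.comp hM).prodMk hs)

variable [mΩ : MeasurableSpace Ω] {P : Measure Ω} [IsProbabilityMeasure P] {f : Measure (MDP S A)}
  (hmeas : Measurable polOf) (hrun : IsRun P f polOf Mstar M s r)
include hmeas hrun

omit [IsProbabilityMeasure P] in
theorem past_le (t : ℕ) : past polOf M s r t ≤ mΩ :=
  Measurable.comap_le (measurable_pi_iff.2 fun j => (hrun.measurable_state j).prodMk
    ((measurable_action hmeas (hrun.measurable_sample _) (hrun.measurable_state j)).prodMk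
      (hrun.measurable_reward j)))

omit [IsProbabilityMeasure P] in
theorem info_le (n t : ℕ) : info polOf Mstar M s r n t ≤ mΩ :=
  Measurable.comap_le (hrun.measurable_true.prodMk
    ((measurable_pi_iff.2 fun j : Fin n => hrun.measurable_sample j).prodMk
      (Measurable.mono (comap_measurable _) (past_le hmeas hrun t) le_rfl)))

/-- Posterior sampling: jointly with the history, the sampled and the true MDP have the same law. -/
theorem map_sample_prod_eq {E : Type*} [MeasurableSpace E] (k : ℕ) {W : Ω → E}
    (hW : Measurable[past polOf M s r (k * τ)] W) :
    P.map (fun ω => (M k ω, W ω)) = P.map fun ω => (Mstar ω, W ω) := by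
  have hpast := past_le hmeas hrun (k * τ)
  have hWm : Measurable W := hW.mono hpast le_rfl
  have hM := hrun.measurable_sample k
  have hMs := hrun.measurable_true
  have : IsProbabilityMeasure (P.map fun ω => (M k ω, W ω)) :=
    Measure.isProbabilityMeasure_map (hM.prodMk hWm).aemeasurable
  refine Measure.ext_prod fun {B D} hB hD => ?_
  rw [Measure.map_apply (hM.prodMk hWm) (hB.prod hD),
    Measure.map_apply (hMs.prodMk hWm) (hB.prod hD)]
  have hC : MeasurableSet[past polOf M s r (k * τ)] (W ⁻¹' D) := hW hD
  -- An event of the history lies both in the past and in the finer `info`. Integrating the two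
  -- conditional probabilities equated by `posterior` over it gives equal masses on rectangles.
  have h1 := setIntegral_condExp (info_le hmeas hrun k (k * τ)) (μ := P)
    (f := (M k ⁻¹' B).indicator fun _ => (1 : ℝ))
    ((integrable_const _).indicator (hM hB)) (past_le_info k (k * τ) _ hC)
  have h2 := setIntegral_condExp hpast (μ := P)
    (f := (Mstar ⁻¹' B).indicator fun _ => (1 : ℝ))
    ((integrable_const _).indicator (hMs hB)) hC
  rw [setIntegral_congr_ae (hpast _ hC) ((hrun.posterior k B hB).mono fun ω hω _ => hω), h2,
    integral_indicator (hM hB), integral_indicator (hMs hB),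
    Measure.restrict_restrict (hM hB), Measure.restrict_restrict (hMs hB)] at h1
  simp only [integral_const, smul_eq_mul, mul_one, measureReal_restrict_apply_univ] at h1
  exact ((measureReal_eq_measureReal_iff).1 h1).symm

theorem integral_sample_eq (k : ℕ) {E : Type*} [MeasurableSpace E] {W : Ω → E}
    (hW : Measurable[past polOf M s r (k * τ)] W) {F : MDP S A × E → ℝ} (hF : Measurable F) :
    ∫ ω, F (M k ω, W ω) ∂P = ∫ ω, F (Mstar ω, W ω) ∂P := by
  have hWm : Measurable W := hW.mono (past_le hmeas hrun (k * τ)) le_rfl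
  rw [← integral_map (φ := fun ω => (M k ω, W ω))
      ((hrun.measurable_sample k).prodMk hWm).aemeasurable hF.aestronglyMeasurable,
    map_sample_prod_eq hmeas hrun k hW,
    integral_map (hrun.measurable_true.prodMk hWm).aemeasurable hF.aestronglyMeasurable]

/-- The deviations of the sampled from the true values of a parameter, at the times when it is
observed, sum up to `√n` up to a logarithm. -/
theorem sum_integral_param_le {v x : ℕ → Ω → ℝ} {θ : MDP S A → ℝ} (hθ : Measurable θ)
    (hθ01 : ∀ M, θ M ∈ Set.Icc (0 : ℝ) 1)
    (hvm : ∀ t, Measurable (v t)) (hxm : ∀ t, Measurable (x t))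
    (hv : ∀ t ω, v t ω = 0 ∨ v t ω = 1) (hx : ∀ t ω, x t ω ∈ Set.Icc (0 : ℝ) 1)
    (hvpast : ∀ k, ∀ u < k * τ, Measurable[past polOf M s r (k * τ)] (v u))
    (hxpast : ∀ k, ∀ u < k * τ, Measurable[past polOf M s r (k * τ)] fun ω => v u ω * x u ω)
    (m : ℕ → MeasurableSpace Ω) (hm : ∀ t, m t ≤ mΩ)
    (hnoise : ∀ t, (∀ ω, v t ω = 0) ∨ (∀ u ≤ t, Measurable[m t] (v u)) ∧
      (∀ u < t, Measurable[m t] fun ω => v u ω * x u ω) ∧ Measurable[m t] Mstar ∧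
      ∃ g : Ω → ℝ, P[x t | m t] =ᵐ[P] g ∧ ∀ ω, v t ω * g ω = v t ω * θ (Mstar ω)) (n : ℕ) :
    ∑ t ∈ Finset.range n, ∫ ω, v t ω * |θ (M (t / τ) ω) - θ (Mstar ω)| ∂P ≤
      (τ + 2) * (√n * (1 + 2 * Real.log (n + 1))) := by
  refine sum_integral_visit_mul_abs_le (c := fun ω => θ (Mstar ω)) (d := fun k ω => θ (M k ω))
    hvm hxm hv hx (hθ.comp hrun.measurable_true) (fun ω => hθ01 _) (fun t => ?_)
    (fun k => hθ.comp (hrun.measurable_sample k)) (fun k ω => hθ01 _) (fun k => ?_) n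
  -- Times that are never visits carry no noise and need no conditional law. This covers transitions
  -- at the last step of an episode and initial states away from its first step.
  · rcases hnoise t with h | ⟨h1, h2, h3, g, h4, h5⟩
    · simp [h]
    · exact integral_noise_eq_zero (hm t) hv hx (fun ω => hθ01 _) (hxm t) h1 h2 (hθ.comp h3) h4 h5
  -- The deviation at the start of episode `k` is a fixed function of the parameter and of the pair
  -- of visit count and observation sum, which the history determines.
  · have h1 := measurable_visits (hvpast k)
    have h2 := measurable_visitSum (hxpast k)
    have hF : Measurable fun p : MDP S A × ℝ × ℝ =>
        (p.2.2 - (p.2.1 + 1) * θ p.1) ^ 2 / (p.2.1 + 1) := by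
      fun_prop
    exact integral_sample_eq hmeas hrun k (h1.prodMk h2) hF

end PSRL

/-! ### Error sums for mean rewards, transition probabilities and initial probabilities. -/

namespace PSRL

variable {S A Ω : Type*} [Fintype S] {τ : ℕ} [NeZero τ]
  [MeasurableSpace S] [DiscreteMeasurableSpace S] [MeasurableSpace A] [DiscreteMeasurableSpace A]
  {polOf : MDP S A → Policy S A τ} {Mstar : Ω → MDP S A} {M : ℕ → Ω → MDP S A}
  {s : ℕ → Ω → S} {r : ℕ → Ω → Set.Icc (0 : ℝ) 1}

theorem measurable_visit {m : MeasurableSpace Ω} {t : ℕ} (hs : Measurable[m] (s t))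
    (ha : Measurable[m] (action polOf M s t)) (y : S) (a : A) :
    Measurable[m] ((visitSet polOf M s y a t).indicator fun _ => (1 : ℝ)) :=
  measurable_const.indicator
    ((hs (measurableSet_singleton y)).inter (ha (measurableSet_singleton a)))

theorem measurable_visit_past {t u : ℕ} (h : u < t) (y : S) (a : A) :
    Measurable[past polOf M s r t] ((visitSet polOf M s y a u).indicator fun _ => (1 : ℝ)) :=
  measurable_visit (measurable_history_component h).fst (measurable_history_component h).snd.fst y a

omit [DiscreteMeasurableSpace A] in
theorem measurable_state_past {t u : ℕ} (h : u < t) (z : S) :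
    Measurable[past polOf M s r t] ((s u ⁻¹' {z}).indicator fun _ => (1 : ℝ)) :=
  measurable_const.indicator ((measurable_history_component h).fst (measurableSet_singleton z))

omit [Fintype S] [NeZero τ] [MeasurableSpace S] [DiscreteMeasurableSpace S] [MeasurableSpace A]
  [DiscreteMeasurableSpace A] in
theorem visit_mul_congr {B : Set Ω} {F G : Ω → ℝ} (h : ∀ ω ∈ B, F ω = G ω) (ω : Ω) :
    B.indicator (fun _ => (1 : ℝ)) ω * F ω = B.indicator (fun _ => (1 : ℝ)) ω * G ω := by
  by_cases hω : ω ∈ B <;> simp [hω, h]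

variable [Fintype A] [mΩ : MeasurableSpace Ω] {P : Measure Ω} [IsProbabilityMeasure P]
  {f : Measure (MDP S A)}
  (hmeas : Measurable polOf) (hrun : IsRun P f polOf Mstar M s r)
include hmeas hrun

omit [IsProbabilityMeasure P] in
theorem measurable_action_run (t : ℕ) : Measurable (action polOf M s t) :=
  measurable_action hmeas (hrun.measurable_sample _) (hrun.measurable_state t)

/-- The conditioning σ-algebra is enlarged by `s t`, so that it determines the visit at time `t`
while the reward is still to be drawn. -/
theorem sum_integral_reward_le (y : S) (a : A) (n : ℕ) :
    ∑ t ∈ Finset.range n, ∫ ω, (visitSet polOf M s y a t).indicator (fun _ => (1 : ℝ)) ω *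
        |(M (t / τ) ω).meanReward y a - (Mstar ω).meanReward y a| ∂P ≤
      (τ + 2) * (√n * (1 + 2 * Real.log (n + 1))) := by
  have hle : ∀ t, past polOf M s r t ≤ info polOf Mstar M s r (t / τ + 1) t ⊔
      MeasurableSpace.comap (s t) inferInstance := fun t => (past_le_info _ _).trans le_sup_left
  have hm : ∀ t, info polOf Mstar M s r (t / τ + 1) t ⊔
      MeasurableSpace.comap (s t) inferInstance ≤ mΩ := fun t =>
    sup_le (info_le hmeas hrun _ _) (hrun.measurable_state t).comap_le
  have hpast : ∀ t u, u < t → Measurable[past polOf M s r t] fun ω =>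
      (visitSet polOf M s y a u).indicator (fun _ => (1 : ℝ)) ω * (r u ω : ℝ) := fun t u hu =>
    (measurable_visit_past hu y a).mul
      (measurable_subtype_coe.comp (measurable_history_component hu).snd.snd)
  have hst : ∀ t, Measurable[info polOf Mstar M s r (t / τ + 1) t ⊔
      MeasurableSpace.comap (s t) inferInstance] (s t) := fun t =>
    (comap_measurable (s t)).mono le_sup_right le_rfl
  have hact : ∀ t, Measurable[info polOf Mstar M s r (t / τ + 1) t ⊔
      MeasurableSpace.comap (s t) inferInstance] (action polOf M s t) := fun t =>
    measurable_action hmeas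
      ((measurable_sample_info (Nat.lt_succ_self _) t).mono le_sup_left le_rfl) (hst t)
  have htrue : ∀ t, Measurable[info polOf Mstar M s r (t / τ + 1) t ⊔
      MeasurableSpace.comap (s t) inferInstance] Mstar := fun t =>
    (measurable_true_info (s := s) (r := r) (M := M) (polOf := polOf) _ t).mono le_sup_left le_rfl
  refine sum_integral_param_le (θ := fun M => M.meanReward y a) (x := fun t ω => (r t ω : ℝ))
    hmeas hrun (MDP.measurable_meanReward y a)
    (fun M => ⟨M.meanReward_nonneg y a, M.meanReward_le_one y a⟩)
    (fun t => measurable_visit (hrun.measurable_state t) (measurable_action_run hmeas hrun t) y a)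
    (fun t => measurable_subtype_coe.comp (hrun.measurable_reward t))
    (fun t => indicator_one_eq _) (fun t ω => (r t ω).2)
    (fun k u hu => measurable_visit_past hu y a) (fun k u hu => hpast _ u hu) _ hm
    (fun t => Or.inr ⟨fun u hu => ?_, fun u hu => (hpast t u hu).mono (hle t) le_rfl, htrue t,
      fun ω => (Mstar ω).meanReward (s t ω) (action polOf M s t ω), ?_, ?_⟩) n
  · rcases hu.lt_or_eq with hu | rfl
    · exact (measurable_visit_past hu y a).mono (hle t) le_rfl
    · exact measurable_visit (hst u) (hact u) y a
  · exact condExp_comp_ae_eq (hm t) (hrun.measurable_reward t)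
      (κ := fun ω => ((Mstar ω).reward (s t ω) (action polOf M s t ω) :
        Measure (Set.Icc (0 : ℝ) 1)))
      (MDP.measurable_reward_uncurry.comp ((htrue t).prodMk ((hst t).prodMk (hact t))))
      (hrun.reward t) measurable_subtype_coe (fun b => b.2.1) (fun b => b.2.2)
  · refine visit_mul_congr fun ω hω => ?_
    rw [hω.1, hω.2]

/-- The observation at time `t` is whether the next state is `z`. The last step of an episode does
not count as a visit, since the state after it is drawn from the initial law. -/
theorem sum_integral_trans_le (y : S) (a : A) (z : S) (n : ℕ) :
    ∑ t ∈ Finset.range n, ∫ ω,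
        ((visitSet polOf M s y a t) ∩ {_ω | ¬ τ ∣ t + 1}).indicator (fun _ => (1 : ℝ)) ω *
        |(M (t / τ) ω).trans y a z - (Mstar ω).trans y a z| ∂P ≤
      (τ + 2) * (√n * (1 + 2 * Real.log (n + 1))) := by
  have hv : ∀ {m : MeasurableSpace Ω} {u : ℕ},
      Measurable[m] ((visitSet polOf M s y a u).indicator fun _ => (1 : ℝ)) →
      Measurable[m] (((visitSet polOf M s y a u) ∩ {_ω | ¬ τ ∣ u + 1}).indicator
        fun _ => (1 : ℝ)) := by
    intro m u h
    by_cases hu : τ ∣ u + 1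
    · simp only [hu, not_true_eq_false, Set.ofPred_false, Set.inter_empty, Set.indicator_empty]
      exact measurable_const
    · simpa only [hu, not_false_eq_true, Set.ofPred_true, Set.inter_univ] using h
  have hle : ∀ t, past polOf M s r (t + 1) ≤ info polOf Mstar M s r (t / τ + 1) (t + 1) :=
    fun t => past_le_info _ _
  refine sum_integral_param_le (θ := fun M => M.trans y a z)
    (x := fun t => (s (t + 1) ⁻¹' {z}).indicator fun _ => (1 : ℝ))
    hmeas hrun (MDP.measurable_trans y a z)
    (fun M => ⟨M.trans_nonneg y a z, M.trans_le_one y a z⟩)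
    (fun t => hv (measurable_visit (hrun.measurable_state t)
      (measurable_action_run hmeas hrun t) y a))
    (fun t => measurable_const.indicator
      (hrun.measurable_state (t + 1) (measurableSet_singleton z)))
    (fun t => indicator_one_eq _) (fun t => indicator_one_mem _)
    (fun k u hu => hv (measurable_visit_past hu y a)) (fun k u hu => ?_)
    _ (fun t => info_le hmeas hrun (t / τ + 1) (t + 1)) (fun t => ?_) n
  -- The observation involves time `u + 1`, which lies outside the history if `u + 1 = k * τ`;
  -- exactly then the visit indicator is zero.
  · by_cases hd : τ ∣ u + 1
    · simp only [hd, not_true_eq_false, Set.ofPred_false, Set.inter_empty, Set.indicator_empty,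
        zero_mul]
      exact measurable_const
    · have hne : u + 1 ≠ k * τ := fun h => hd (h ▸ Dvd.intro_left k rfl)
      exact (hv (measurable_visit_past hu y a)).mul (measurable_state_past (by omega) z)
  · by_cases hd : τ ∣ t + 1
    · exact Or.inl fun ω => by simp [hd]
    · refine Or.inr ⟨fun u hu => ?_, fun u hu => ?_, measurable_true_info _ _,
        fun ω => (Mstar ω).trans (s t ω) (action polOf M s t ω) z, hrun.transition t z hd, ?_⟩
      · exact (hv (measurable_visit_past (by omega) y a)).mono (hle t) le_rfl
      · exact ((hv (measurable_visit_past (by omega) y a)).mul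
          (measurable_state_past (by omega) z)).mono (hle t) le_rfl
      · refine visit_mul_congr fun ω hω => ?_
        rw [hω.1.1, hω.1.2]

/-- The visits are deterministic, one at the start of each episode. -/
theorem sum_integral_init_le (z : S) (n : ℕ) :
    ∑ t ∈ Finset.range n, ∫ ω, (if τ ∣ t then 1 else 0) *
        |(M (t / τ) ω).init z - (Mstar ω).init z| ∂P ≤
      (τ + 2) * (√n * (1 + 2 * Real.log (n + 1))) := by
  refine sum_integral_param_le (θ := fun M => M.init z) (v := fun t _ => if τ ∣ t then 1 else 0)
    (x := fun t => (s t ⁻¹' {z}).indicator fun _ => (1 : ℝ))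
    hmeas hrun (MDP.measurable_init z) (fun M => ⟨M.init_nonneg z, M.init_le_one z⟩)
    (fun t => measurable_const)
    (fun t => measurable_const.indicator (hrun.measurable_state t (measurableSet_singleton z)))
    (fun t ω => (ite_eq_or_eq _ _ _).symm) (fun t => indicator_one_mem _)
    (fun k u hu => measurable_const)
    (fun k u hu => measurable_const.mul (measurable_state_past hu z))
    _ (fun t => info_le hmeas hrun (t / τ + 1) t) (fun t => ?_) n
  by_cases hd : τ ∣ t
  · refine Or.inr ⟨fun u hu => measurable_const, fun u hu => ?_, measurable_true_info _ _,
      fun ω => (Mstar ω).init z, ?_, fun ω => rfl⟩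
    · exact (measurable_const.mul (measurable_state_past hu z)).mono (past_le_info _ _) le_rfl
    · have := hrun.initial (t / τ) z
      rwa [Nat.div_mul_cancel hd] at this
  · exact Or.inl fun ω => if_neg hd

end PSRL

/-! ### Comparison of the values of one policy in two MDPs. -/

namespace MDP

variable {S A : Type*} [Fintype S] {τ : ℕ} [NeZero τ]

/-- By the Bellman equation and `N.trans * N.value - M.trans * M.value = (N.trans - M.trans) *
N.value + M.trans * (N.value - M.value)`, with values in `[0, τ]`. The remaining difference is
averaged under `M`, the role played by the true MDP, and so can be followed along the true
trajectory. -/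
theorem value_sub_le (N M : MDP S A) (μ : Policy S A τ) (i : ℕ) (hi : i + 1 < τ) (s : S) :
    N.value μ ⟨i, by omega⟩ s - M.value μ ⟨i, by omega⟩ s ≤
      |N.meanReward s (μ s ⟨i, by omega⟩) - M.meanReward s (μ s ⟨i, by omega⟩)| +
      τ * ∑ z, |N.trans s (μ s ⟨i, by omega⟩) z - M.trans s (μ s ⟨i, by omega⟩) z| +
      ∑ z, M.trans s (μ s ⟨i, by omega⟩) z *
        (N.value μ ⟨i + 1, hi⟩ z - M.value μ ⟨i + 1, hi⟩ z) := by
  rw [value_succ _ _ _ hi, value_succ _ _ _ hi, Finset.mul_sum]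
  set a := μ s ⟨i, by omega⟩
  have h : ∀ z, N.trans s a z * N.value μ ⟨i + 1, hi⟩ z - M.trans s a z * M.value μ ⟨i + 1, hi⟩ z ≤
      τ * |N.trans s a z - M.trans s a z| +
        M.trans s a z * (N.value μ ⟨i + 1, hi⟩ z - M.value μ ⟨i + 1, hi⟩ z) := fun z => by
    have h0 := N.value_nonneg μ ⟨i + 1, hi⟩ z
    have h1 := N.value_le μ ⟨i + 1, hi⟩ z
    have h2 := mul_le_mul_of_nonneg_right (le_abs_self (N.trans s a z - M.trans s a z)) h0
    have h3 := mul_le_mul_of_nonneg_left h1 (abs_nonneg (N.trans s a z - M.trans s a z))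
    linarith
  have h' := Finset.sum_le_sum fun z (_ : z ∈ Finset.univ) => h z
  rw [Finset.sum_sub_distrib, Finset.sum_add_distrib] at h'
  linarith [le_abs_self (N.meanReward s a - M.meanReward s a)]

theorem initValue_sub_le (N M : MDP S A) (μ : Policy S A τ) :
    N.initValue μ - M.initValue μ ≤ τ * ∑ z, |N.init z - M.init z| +
      ∑ z, M.init z * (N.value μ 0 z - M.value μ 0 z) := by
  simp only [initValue]
  rw [← Finset.sum_sub_distrib, Finset.mul_sum, ← Finset.sum_add_distrib]
  refine Finset.sum_le_sum fun z _ => ?_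
  have h0 := N.value_nonneg μ 0 z
  have h1 := N.value_le μ 0 z
  have h2 := mul_le_mul_of_nonneg_right (le_abs_self (N.init z - M.init z)) h0
  have h3 := mul_le_mul_of_nonneg_left h1 (abs_nonneg (N.init z - M.init z))
  linarith

theorem abs_value_sub_le (N M : MDP S A) (μ : Policy S A τ) (i : Fin τ) (s : S) :
    |N.value μ i s - M.value μ i s| ≤ τ := by
  have h0 := N.value_nonneg μ i s
  have h1 := N.value_le μ i s
  have h2 := M.value_nonneg μ i s
  have h3 := M.value_le μ i s
  rw [abs_le]
  constructor <;> linarith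

section

variable {Ω : Type*} [Fintype A] [MeasurableSpace A] [DiscreteMeasurableSpace A]
  {m : MeasurableSpace Ω} {N M : Ω → MDP S A} {μ : Ω → Policy S A τ}

theorem measurable_value_state [MeasurableSpace S] [DiscreteMeasurableSpace S]
    (hN : Measurable N) (hμ : Measurable μ) (i : Fin τ) {X : Ω → S} (hX : Measurable X) :
    Measurable fun ω => (N ω).value (μ ω) i (X ω) := by
  have h := (measurable_value_uncurry (S := S) (A := A) i).comp ((hN.prodMk hμ).prodMk hX)
  exact h

theorem measurable_value_sub (hN : Measurable N) (hM : Measurable M) (hμ : Measurable μ)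
    (i : Fin τ) (x : S) :
    Measurable fun ω => (N ω).value (μ ω) i x - (M ω).value (μ ω) i x := by
  have h1 := (measurable_value_prod (S := S) (A := A) i x).comp (hN.prodMk hμ)
  have h2 := (measurable_value_prod (S := S) (A := A) i x).comp (hM.prodMk hμ)
  have h1' : Measurable fun ω => (N ω).value (μ ω) i x := h1
  have h2' : Measurable fun ω => (M ω).value (μ ω) i x := h2
  exact Measurable.sub h1' h2'

end

end MDP

/-! ### Expected regret of one episode through the errors along the true trajectory. -/

namespace PSRL

/-- Averaging over a random state with conditional law `g` given `m`. -/
theorem integral_state_eq {S Ω : Type*} [Fintype S] [MeasurableSpace S]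
    [DiscreteMeasurableSpace S] {m : MeasurableSpace Ω} [mΩ : MeasurableSpace Ω] {P : Measure Ω}
    [IsProbabilityMeasure P] (hm : m ≤ mΩ) {X : Ω → S}
    (hX : Measurable X) {g Y : S → Ω → ℝ}
    (h : ∀ x, P⟦X ⁻¹' {x} | m⟧ =ᵐ[P] g x) (hY : ∀ x, Measurable[m] (Y x)) (C : ℝ)
    (hC : ∀ x ω, |Y x ω| ≤ C) :
    Integrable (fun ω => ∑ x, g x ω * Y x ω) P ∧
      ∫ ω, ∑ x, g x ω * Y x ω ∂P = ∫ ω, Y (X ω) ω ∂P := by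
  have hB : ∀ x, Integrable ((X ⁻¹' {x}).indicator fun _ => (1 : ℝ)) P := fun x =>
    (integrable_const _).indicator (hX (measurableSet_singleton x))
  have hYm : ∀ x, AEStronglyMeasurable (Y x) P := fun x =>
    ((hY x).mono hm le_rfl).aestronglyMeasurable
  have hi : ∀ x, Integrable (fun ω => Y x ω * g x ω) P := fun x =>
    (integrable_condExp.congr (h x)).bdd_mul (hYm x) (ae_of_all _ (hC x))
  have hi' : ∀ x, Integrable (fun ω => Y x ω * (X ⁻¹' {x}).indicator (fun _ => (1 : ℝ)) ω) P :=
    fun x => (hB x).bdd_mul (hYm x) (ae_of_all _ (hC x))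
  simp_rw [mul_comm (g _ _)]
  refine ⟨integrable_finsetSum _ fun x _ => hi x, ?_⟩
  rw [integral_finsetSum _ fun x _ => hi x]
  simp_rw [← integral_mul_of_condExp_ae_eq hm (hB _) (h _) (hY _) C (hC _)]
  rw [← integral_finsetSum _ fun x _ => hi' x]
  refine integral_congr_ae (ae_of_all _ fun ω => ?_)
  simp only
  rw [Finset.sum_eq_single (X ω)]
  · simp
  · intro x _ hx
    rw [Set.indicator_of_notMem (by simpa using hx.symm), mul_zero]
  · simp

variable {S A Ω : Type*} [Fintype S] {τ : ℕ} [NeZero τ]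
  [MeasurableSpace S] [DiscreteMeasurableSpace S] [MeasurableSpace A] [DiscreteMeasurableSpace A]
  {polOf : MDP S A → Policy S A τ} {Mstar : Ω → MDP S A} {M : ℕ → Ω → MDP S A}
  {s : ℕ → Ω → S} {r : ℕ → Ω → Set.Icc (0 : ℝ) 1}
  [Fintype A] [mΩ : MeasurableSpace Ω] {P : Measure Ω} [IsProbabilityMeasure P]
  {f : Measure (MDP S A)}

variable (polOf Mstar M s) in
/-- The deviation of the sampled from the true initial law at the start of an episode. -/
def initErr (t : ℕ) (ω : Ω) : ℝ :=
  ∑ z, (if τ ∣ t then 1 else 0) * |(M (t / τ) ω).init z - (Mstar ω).init z|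

variable (polOf Mstar M s) in
/-- The deviation of the sampled from the true mean reward for the current state and action. -/
def rewardErr (t : ℕ) (ω : Ω) : ℝ :=
  ∑ y, ∑ a, (visitSet polOf M s y a t).indicator (fun _ => (1 : ℝ)) ω *
    |(M (t / τ) ω).meanReward y a - (Mstar ω).meanReward y a|

variable (polOf Mstar M s) in
/-- The deviation of the sampled from the true transition law for the current state and action,
before the last step of an episode. -/
def transErr (t : ℕ) (ω : Ω) : ℝ :=
  ∑ y, ∑ a, ∑ z, ((visitSet polOf M s y a t) ∩ {_ω | ¬ τ ∣ t + 1}).indicator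
    (fun _ => (1 : ℝ)) ω * |(M (t / τ) ω).trans y a z - (Mstar ω).trans y a z|

omit [MeasurableSpace S] [DiscreteMeasurableSpace S] [MeasurableSpace A]
  [DiscreteMeasurableSpace A] mΩ in
theorem sum_visit_mul (t : ℕ) (ω : Ω) (F : S → A → ℝ) :
    ∑ y, ∑ a, (visitSet polOf M s y a t).indicator (fun _ => (1 : ℝ)) ω * F y a =
      F (s t ω) (action polOf M s t ω) := by
  rw [Finset.sum_eq_single (s t ω), Finset.sum_eq_single (action polOf M s t ω)]
  · simp [visitSet]
  · intro a _ ha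
    rw [Set.indicator_of_notMem (fun h => ha h.2.symm), zero_mul]
  · simp
  · intro y _ hy
    refine Finset.sum_eq_zero fun a _ => ?_
    rw [Set.indicator_of_notMem (fun h => hy h.1.symm), zero_mul]
  · simp

omit [MeasurableSpace S] [DiscreteMeasurableSpace S] [MeasurableSpace A]
  [DiscreteMeasurableSpace A] mΩ in
theorem rewardErr_eq (t : ℕ) (ω : Ω) : rewardErr polOf Mstar M s t ω =
    |(M (t / τ) ω).meanReward (s t ω) (action polOf M s t ω) -
      (Mstar ω).meanReward (s t ω) (action polOf M s t ω)| :=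
  sum_visit_mul t ω fun y a => |(M (t / τ) ω).meanReward y a - (Mstar ω).meanReward y a|

omit [MeasurableSpace S] [DiscreteMeasurableSpace S] [MeasurableSpace A]
  [DiscreteMeasurableSpace A] mΩ in
theorem transErr_eq {t : ℕ} (ht : ¬ τ ∣ t + 1) (ω : Ω) : transErr polOf Mstar M s t ω =
    ∑ z, |(M (t / τ) ω).trans (s t ω) (action polOf M s t ω) z -
      (Mstar ω).trans (s t ω) (action polOf M s t ω) z| := by
  simp only [transErr, ht, not_false_eq_true, Set.ofPred_true, Set.inter_univ, ← Finset.mul_sum]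
  exact sum_visit_mul t ω fun y a => ∑ z, |(M (t / τ) ω).trans y a z - (Mstar ω).trans y a z|

omit [MeasurableSpace S] [DiscreteMeasurableSpace S] [MeasurableSpace A]
  [DiscreteMeasurableSpace A] [Fintype A] [NeZero τ] mΩ in
theorem initErr_nonneg (t : ℕ) (ω : Ω) : 0 ≤ initErr (τ := τ) Mstar M t ω :=
  Finset.sum_nonneg fun z _ => mul_nonneg (by split_ifs <;> norm_num) (abs_nonneg _)

omit [MeasurableSpace S] [DiscreteMeasurableSpace S] [MeasurableSpace A]
  [DiscreteMeasurableSpace A] mΩ in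
theorem transErr_nonneg (t : ℕ) (ω : Ω) : 0 ≤ transErr polOf Mstar M s t ω :=
  Finset.sum_nonneg fun _ _ => Finset.sum_nonneg fun _ _ => Finset.sum_nonneg fun _ _ =>
    mul_nonneg (indicator_one_mem _ _).1 (abs_nonneg _)

omit [MeasurableSpace S] [DiscreteMeasurableSpace S] [MeasurableSpace A]
  [DiscreteMeasurableSpace A] [Fintype A] mΩ [Fintype S] in
theorem episode_index (k : ℕ) {i : ℕ} (hi : i < τ) : (k * τ + i) / τ = k := by
  rw [mul_comm, Nat.mul_add_div (NeZero.pos τ), Nat.div_eq_of_lt hi, add_zero]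

omit [MeasurableSpace S] [DiscreteMeasurableSpace S] [MeasurableSpace A]
  [DiscreteMeasurableSpace A] [Fintype A] mΩ in
theorem action_eq (k : ℕ) {i : ℕ} (hi : i < τ) (ω : Ω) :
    action polOf M s (k * τ + i) ω = polOf (M k ω) (s (k * τ + i) ω) ⟨i, hi⟩ := by
  rw [action, episode_index k hi]
  congr 1
  ext
  simp [Nat.mod_eq_of_lt hi]

theorem integrable_abs_sub {g h : Ω → ℝ} (hg : Measurable g) (hh : Measurable h)
    (hg1 : ∀ ω, g ω ∈ Set.Icc (0 : ℝ) 1) (hh1 : ∀ ω, h ω ∈ Set.Icc (0 : ℝ) 1) {v : Ω → ℝ}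
    (hv : Measurable v) (hv1 : ∀ ω, v ω ∈ Set.Icc (0 : ℝ) 1) :
    Integrable (fun ω => v ω * |g ω - h ω|) P := by
  have hm : Measurable fun ω => v ω * |g ω - h ω| :=
    hv.mul (continuous_abs.measurable.comp (hg.sub hh))
  refine integrable_of_measurable_of_abs_le hm 1 fun ω => ?_
  rw [abs_mul, abs_abs, abs_of_nonneg (hv1 ω).1]
  refine mul_le_one₀ (hv1 ω).2 (abs_nonneg _) ?_
  rw [abs_le]
  constructor <;> linarith [(hg1 ω).1, (hg1 ω).2, (hh1 ω).1, (hh1 ω).2]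

variable (hmeas : Measurable polOf) (hrun : IsRun P f polOf Mstar M s r)
include hmeas hrun

omit hmeas in
omit [Fintype A] [DiscreteMeasurableSpace S] [DiscreteMeasurableSpace A] in
theorem integrable_init_term (z : S) (t : ℕ) : Integrable (fun ω => (if τ ∣ t then 1 else 0) *
    |(M (t / τ) ω).init z - (Mstar ω).init z|) P :=
  integrable_abs_sub ((MDP.measurable_init z).comp (hrun.measurable_sample _))
    ((MDP.measurable_init z).comp hrun.measurable_true)
    (fun _ => ⟨MDP.init_nonneg _ z, MDP.init_le_one _ z⟩)
    (fun _ => ⟨MDP.init_nonneg _ z, MDP.init_le_one _ z⟩) measurable_const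
    fun ω => by split_ifs <;> simp

theorem integrable_reward_term (y : S) (a : A) (t : ℕ) : Integrable (fun ω =>
    (visitSet polOf M s y a t).indicator (fun _ => (1 : ℝ)) ω *
      |(M (t / τ) ω).meanReward y a - (Mstar ω).meanReward y a|) P :=
  integrable_abs_sub ((MDP.measurable_meanReward y a).comp (hrun.measurable_sample _))
    ((MDP.measurable_meanReward y a).comp hrun.measurable_true)
    (fun _ => ⟨MDP.meanReward_nonneg _ y a, MDP.meanReward_le_one _ y a⟩)
    (fun _ => ⟨MDP.meanReward_nonneg _ y a, MDP.meanReward_le_one _ y a⟩)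
    (measurable_visit (hrun.measurable_state t) (measurable_action_run hmeas hrun t) y a)
    (indicator_one_mem _)

theorem integrable_trans_term (y : S) (a : A) (z : S) (t : ℕ) : Integrable (fun ω =>
    ((visitSet polOf M s y a t) ∩ {_ω | ¬ τ ∣ t + 1}).indicator (fun _ => (1 : ℝ)) ω *
      |(M (t / τ) ω).trans y a z - (Mstar ω).trans y a z|) P :=
  integrable_abs_sub ((MDP.measurable_trans y a z).comp (hrun.measurable_sample _))
    ((MDP.measurable_trans y a z).comp hrun.measurable_true)
    (fun _ => ⟨MDP.trans_nonneg _ y a z, MDP.trans_le_one _ y a z⟩)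
    (fun _ => ⟨MDP.trans_nonneg _ y a z, MDP.trans_le_one _ y a z⟩)
    (measurable_const.indicator (((hrun.measurable_state t (measurableSet_singleton y)).inter
      (measurable_action_run hmeas hrun t (measurableSet_singleton a))).inter
        (MeasurableSet.const _)))
    (indicator_one_mem _)

omit hmeas in
omit [Fintype A] [DiscreteMeasurableSpace S] [DiscreteMeasurableSpace A] in
theorem integrable_initErr (t : ℕ) : Integrable (initErr (τ := τ) Mstar M t) P :=
  integrable_finsetSum _ fun z _ => integrable_init_term hrun z t

theorem integrable_rewardErr (t : ℕ) : Integrable (rewardErr polOf Mstar M s t) P :=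
  integrable_finsetSum _ fun y _ => integrable_finsetSum _ fun a _ =>
    integrable_reward_term hmeas hrun y a t

theorem integrable_transErr (t : ℕ) : Integrable (transErr polOf Mstar M s t) P :=
  integrable_finsetSum _ fun y _ => integrable_finsetSum _ fun a _ =>
    integrable_finsetSum _ fun z _ => integrable_trans_term hmeas hrun y a z t

theorem sum_integral_initErr_le (n : ℕ) :
    ∑ t ∈ Finset.range n, ∫ ω, initErr (τ := τ) Mstar M t ω ∂P ≤
      Fintype.card S * ((τ + 2) * (√n * (1 + 2 * Real.log (n + 1)))) := by
  simp only [initErr]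
  simp_rw [integral_finsetSum _ fun z _ => integrable_init_term hrun z _]
  rw [Finset.sum_comm]
  refine (Finset.sum_le_card_nsmul _ _ _ fun z _ =>
    sum_integral_init_le hmeas hrun z n).trans_eq ?_
  rw [nsmul_eq_mul, Finset.card_univ]

theorem sum_integral_rewardErr_le (n : ℕ) :
    ∑ t ∈ Finset.range n, ∫ ω, rewardErr polOf Mstar M s t ω ∂P ≤
      Fintype.card (S × A) * ((τ + 2) * (√n * (1 + 2 * Real.log (n + 1)))) := by
  simp only [rewardErr, ← Fintype.sum_prod_type']
  simp_rw [integral_finsetSum _ fun (p : S × A) _ => integrable_reward_term hmeas hrun p.1 p.2 _]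
  rw [Finset.sum_comm]
  refine (Finset.sum_le_card_nsmul _ _ _ fun p _ =>
    sum_integral_reward_le hmeas hrun p.1 p.2 n).trans_eq ?_
  rw [nsmul_eq_mul, Finset.card_univ]

theorem sum_integral_transErr_le (n : ℕ) :
    ∑ t ∈ Finset.range n, ∫ ω, transErr polOf Mstar M s t ω ∂P ≤
      Fintype.card (S × A × S) * ((τ + 2) * (√n * (1 + 2 * Real.log (n + 1)))) := by
  simp only [transErr, ← Fintype.sum_prod_type']
  simp_rw [integral_finsetSum _ fun (p : S × A × S) _ =>
    integrable_trans_term hmeas hrun p.1 p.2.1 p.2.2 _]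
  rw [Finset.sum_comm]
  refine (Finset.sum_le_card_nsmul _ _ _ fun p _ =>
    sum_integral_trans_le hmeas hrun p.1 p.2.1 p.2.2 n).trans_eq ?_
  rw [nsmul_eq_mul, Finset.card_univ]

/-- The expected overestimation of the value of the current policy, along the true states. -/
theorem integral_value_diff_le (k j : ℕ) : ∀ (i : ℕ) (h : i + j + 1 = τ),
    ∫ ω, ((M k ω).value (polOf (M k ω)) ⟨i, by omega⟩ (s (k * τ + i) ω) -
      (Mstar ω).value (polOf (M k ω)) ⟨i, by omega⟩ (s (k * τ + i) ω)) ∂P ≤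
    ∑ l ∈ Finset.range (j + 1), (∫ ω, rewardErr polOf Mstar M s (k * τ + (i + l)) ω ∂P +
      τ * ∫ ω, transErr polOf Mstar M s (k * τ + (i + l)) ω ∂P) := by
  have hint : ∀ i (hi : i < τ), Integrable (fun ω =>
      (M k ω).value (polOf (M k ω)) ⟨i, hi⟩ (s (k * τ + i) ω) -
        (Mstar ω).value (polOf (M k ω)) ⟨i, hi⟩ (s (k * τ + i) ω)) P := fun i hi => by
    have hM := hrun.measurable_sample k
    have hs := hrun.measurable_state (k * τ + i)
    have hm1 := MDP.measurable_value_state hM (hmeas.comp hM) ⟨i, hi⟩ hs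
    have hm2 := MDP.measurable_value_state hrun.measurable_true (hmeas.comp hM) ⟨i, hi⟩ hs
    exact integrable_of_measurable_of_abs_le (hm1.sub hm2) τ
      fun ω => MDP.abs_value_sub_le _ _ _ _ _
  -- Backward induction over the episode: `j` is the number of steps after step `i`.
  induction j with
  | zero =>
    intro i h
    rw [zero_add, Finset.sum_range_one, add_zero]
    have h1 : ∫ ω, ((M k ω).value (polOf (M k ω)) ⟨i, by omega⟩ (s (k * τ + i) ω) -
        (Mstar ω).value (polOf (M k ω)) ⟨i, by omega⟩ (s (k * τ + i) ω)) ∂P ≤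
        ∫ ω, rewardErr polOf Mstar M s (k * τ + i) ω ∂P := by
      refine integral_mono (hint i (by omega)) (integrable_rewardErr hmeas hrun _) fun ω => ?_
      simp only
      rw [MDP.value_last _ _ _ h, MDP.value_last _ _ _ h, rewardErr_eq,
        action_eq k (show i < τ by omega), episode_index k (show i < τ by omega)]
      exact le_abs_self _
    have h2 : 0 ≤ ∫ ω, transErr polOf Mstar M s (k * τ + i) ω ∂P :=
      integral_nonneg fun ω => transErr_nonneg _ _
    have h3 : 0 ≤ (τ : ℝ) * ∫ ω, transErr polOf Mstar M s (k * τ + i) ω ∂P := by positivity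
    linarith
  | succ j ih =>
    intro i h
    have hi : i < τ := by omega
    have hd : ¬ τ ∣ k * τ + i + 1 := by
      rw [add_assoc, Nat.dvd_add_right (Dvd.intro_left k rfl)]
      exact Nat.not_dvd_of_pos_of_lt (by omega) (by omega)
    have htrans := fun x => hrun.transition (k * τ + i) x hd
    rw [episode_index k hi] at htrans
    have hi' : i + 1 < τ := by omega
    have hM : Measurable[info polOf Mstar M s r (k + 1) (k * τ + i + 1)] (M k) :=
      measurable_sample_info (Nat.lt_succ_self k) _
    have hMs : Measurable[info polOf Mstar M s r (k + 1) (k * τ + i + 1)] Mstar :=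
      measurable_true_info _ _
    have hY := fun x => MDP.measurable_value_sub hM hMs (hmeas.comp hM) ⟨i + 1, hi'⟩ x
    -- The average over the true transition law becomes the value difference at the actual next
    -- state, to which the induction hypothesis applies.
    obtain ⟨h1, h2⟩ := integral_state_eq (info_le hmeas hrun _ _)
      (hrun.measurable_state (k * τ + i + 1)) htrans hY τ
      (fun x ω => MDP.abs_value_sub_le (M k ω) (Mstar ω) (polOf (M k ω)) ⟨i + 1, hi'⟩ x)
    have hR := integrable_rewardErr hmeas hrun (k * τ + i)
    have hT := (integrable_transErr hmeas hrun (k * τ + i)).const_mul (τ : ℝ)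
    have h3 := integral_mono (hint i hi) ((hR.add hT).add h1) fun ω => by
      simp only [Pi.add_apply]
      rw [rewardErr_eq, transErr_eq hd, action_eq k hi, episode_index k hi]
      exact MDP.value_sub_le (M k ω) (Mstar ω) (polOf (M k ω)) i hi' _
    rw [integral_add' (hR.add hT) h1, integral_add' hR hT, integral_const_mul, h2] at h3
    have h4 := ih (i + 1) (by omega)
    rw [Finset.sum_range_succ']
    simp only [add_zero]
    have h5 : ∀ l, i + 1 + l = i + (l + 1) := fun l => by ring
    simp only [h5] at h4
    refine h3.trans ?_
    rw [add_comm]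
    exact add_le_add_left h4 _

omit hrun [MeasurableSpace S] [DiscreteMeasurableSpace S] in
theorem integrable_initValue {N N' : Ω → MDP S A} (hN : Measurable N) (hN' : Measurable N') :
    Integrable (fun ω => (N ω).initValue (polOf (N' ω))) P := by
  have h := MDP.measurable_initValue_uncurry.comp (hN.prodMk (hmeas.comp hN'))
  refine integrable_of_measurable_of_abs_le h τ fun ω => ?_
  rw [abs_of_nonneg (MDP.initValue_nonneg _ _)]
  exact MDP.initValue_le _ _

omit [DiscreteMeasurableSpace S] in
theorem integrable_episodeRegret (k : ℕ) :
    Integrable (fun ω => (Mstar ω).episodeRegret (polOf (Mstar ω)) (polOf (M k ω))) P := by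
  simp_rw [MDP.episodeRegret_eq]
  exact (integrable_initValue hmeas hrun.measurable_true hrun.measurable_true).sub
    (integrable_initValue hmeas hrun.measurable_true (hrun.measurable_sample k))

theorem integral_episodeRegret_le (k : ℕ) :
    ∫ ω, (Mstar ω).episodeRegret (polOf (Mstar ω)) (polOf (M k ω)) ∂P ≤
      ∑ l ∈ Finset.range τ, (τ * ∫ ω, initErr (τ := τ) Mstar M (k * τ + l) ω ∂P +
        (∫ ω, rewardErr polOf Mstar M s (k * τ + l) ω ∂P +
          τ * ∫ ω, transErr polOf Mstar M s (k * τ + l) ω ∂P)) := by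
  have hM := hrun.measurable_sample k
  have hMs := hrun.measurable_true
  have hint : ∀ {N N' : Ω → MDP S A}, Measurable N → Measurable N' →
      Integrable (fun ω => (N ω).initValue (polOf (N' ω))) P := fun hN hN' =>
    integrable_initValue hmeas hN hN'
  -- Only equality of the unconditional laws is needed here, hence the trivial `W`.
  have hpost : ∫ ω, (M k ω).initValue (polOf (M k ω)) ∂P =
      ∫ ω, (Mstar ω).initValue (polOf (Mstar ω)) ∂P :=
    integral_sample_eq hmeas hrun k (W := fun _ => ()) measurable_const
      (F := fun p => p.1.initValue (polOf p.1))
      (MDP.measurable_initValue_uncurry.comp (measurable_fst.prodMk (hmeas.comp measurable_fst)))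
  have hM' : Measurable[info polOf Mstar M s r (k + 1) (k * τ)] (M k) :=
    measurable_sample_info (Nat.lt_succ_self k) _
  have hMs' : Measurable[info polOf Mstar M s r (k + 1) (k * τ)] Mstar :=
    measurable_true_info _ _
  have hY := fun x => MDP.measurable_value_sub hM' hMs' (hmeas.comp hM') 0 x
  obtain ⟨h1, h2⟩ := integral_state_eq (info_le hmeas hrun _ _)
    (hrun.measurable_state (k * τ)) (hrun.initial k) hY τ
    (fun x ω => MDP.abs_value_sub_le (M k ω) (Mstar ω) (polOf (M k ω)) 0 x)
  have hI := (integrable_initErr hrun (k * τ)).const_mul (τ : ℝ)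
  have h3 := integral_mono ((hint hM hM).sub (hint hMs hM)) (hI.add h1) fun ω => by
    simp only [Pi.add_apply, Pi.sub_apply]
    have := MDP.initValue_sub_le (M k ω) (Mstar ω) (polOf (M k ω))
    simpa [initErr, Nat.mul_div_cancel k (NeZero.pos τ)] using this
  rw [integral_add' hI h1, integral_sub' (hint hM hM) (hint hMs hM), hpost, integral_const_mul,
    h2] at h3
  simp_rw [MDP.episodeRegret_eq]
  rw [integral_sub (hint hMs hMs) (hint hMs hM)]
  refine h3.trans ?_
  have hτ : τ - 1 + 1 = τ := Nat.sub_add_cancel (NeZero.pos τ)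
  have h4 := integral_value_diff_le hmeas hrun k (τ - 1) 0 (by omega)
  simp only [hτ, zero_add, add_zero] at h4
  rw [Finset.sum_add_distrib]
  refine add_le_add ?_ h4
  -- Only the term `l = 0` is needed; the nonnegative others are added so that the episodes combine
  -- into one sum over all times.
  have h5 : ∀ l, 0 ≤ (τ : ℝ) * ∫ ω, initErr (τ := τ) Mstar M (k * τ + l) ω ∂P := fun l =>
    mul_nonneg (Nat.cast_nonneg _) (integral_nonneg fun ω => initErr_nonneg _ _)
  exact Finset.single_le_sum (f := fun l => (τ : ℝ) * ∫ ω, initErr (τ := τ) Mstar M (k * τ + l) ω ∂P)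
    (fun l _ => h5 l) (Finset.mem_range.2 (NeZero.pos τ))

end PSRL

/-! ### Summation over episodes and asymptotics. -/

namespace PSRL

theorem sum_range_mul_eq (F : ℕ → ℝ) (K τ : ℕ) :
    ∑ k ∈ Finset.range K, ∑ l ∈ Finset.range τ, F (k * τ + l) =
      ∑ t ∈ Finset.range (K * τ), F t := by
  induction K with
  | zero => simp
  | succ K ih => rw [Finset.sum_range_succ, ih, Nat.succ_mul, Finset.sum_range_add]

theorem tendsto_sqrt_mul_log_div_rpow {α : ℝ} (hα : 1 / 2 < α) :
    Tendsto (fun y : ℝ => √y * (1 + 2 * Real.log y) / y ^ α) atTop (𝓝 0) := by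
  have hδ : 0 < α - 1 / 2 := by linarith
  have h1 : (fun y : ℝ => 1 + 2 * Real.log y) =o[atTop] fun y : ℝ => y ^ (α - 1 / 2) := by
    refine Asymptotics.IsLittleO.add ?_ ((isLittleO_log_rpow_atTop hδ).const_mul_left 2)
    exact Asymptotics.isLittleO_const_left.2 (Or.inr
      (tendsto_norm_atTop_atTop.comp (tendsto_rpow_atTop hδ)))
  refine h1.tendsto_div_nhds_zero.congr' ?_
  filter_upwards [eventually_gt_atTop 0] with y hy
  rw [Real.rpow_sub hy, Real.sqrt_eq_rpow]
  have h2 : 0 < y ^ α := Real.rpow_pos_of_pos hy _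
  have h3 : 0 < y ^ (1 / 2 : ℝ) := Real.rpow_pos_of_pos hy _
  field_simp

theorem ceil_div_mul_le (T τ : ℕ) [NeZero τ] : ⌈(T : ℝ) / τ⌉₊ * τ ≤ T + τ := by
  have hτ : (0 : ℝ) < τ := by exact_mod_cast NeZero.pos τ
  have h := (Nat.ceil_lt_add_one (show 0 ≤ (T : ℝ) / τ by positivity)).le
  have h1 := mul_le_mul_of_nonneg_right h hτ.le
  rw [add_mul, one_mul, div_mul_cancel₀ _ hτ.ne'] at h1
  exact_mod_cast h1

variable {S A Ω : Type*} [Fintype S] {τ : ℕ} [NeZero τ]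
  [MeasurableSpace S] [DiscreteMeasurableSpace S] [MeasurableSpace A] [DiscreteMeasurableSpace A]
  {polOf : MDP S A → Policy S A τ} {Mstar : Ω → MDP S A} {M : ℕ → Ω → MDP S A}
  {s : ℕ → Ω → S} {r : ℕ → Ω → Set.Icc (0 : ℝ) 1}
  [Fintype A] [mΩ : MeasurableSpace Ω] {P : Measure Ω} [IsProbabilityMeasure P]
  {f : Measure (MDP S A)}

omit [MeasurableSpace S] [DiscreteMeasurableSpace S] [MeasurableSpace A]
  [DiscreteMeasurableSpace A] [Fintype A] mΩ in
theorem regret_nonneg (hopt : ∀ M : MDP S A, M.IsOptimal (polOf M)) (T : ℕ) (ω : Ω) :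
    0 ≤ regret polOf Mstar M T ω :=
  Finset.sum_nonneg fun _ _ => MDP.episodeRegret_nonneg _ _ _ (hopt _)

omit [DiscreteMeasurableSpace S] in
theorem integrable_regret (hmeas : Measurable polOf) (hrun : IsRun P f polOf Mstar M s r) (T : ℕ) :
    Integrable (regret polOf Mstar M T) P :=
  integrable_finsetSum _ fun k _ => integrable_episodeRegret hmeas hrun k

/-- The Bayesian regret of posterior sampling is of order `√T` up to a logarithm. -/
theorem exists_integral_regret_le (hmeas : Measurable polOf)
    (hrun : IsRun P f polOf Mstar M s r) :
    ∃ C : ℝ, 0 ≤ C ∧ ∀ T : ℕ, ∫ ω, regret polOf Mstar M T ω ∂P ≤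
      C * (√((T + τ : ℕ) : ℝ) * (1 + 2 * Real.log ((T + τ : ℕ) + 1))) := by
  refine ⟨(τ * Fintype.card S + (Fintype.card (S × A) + τ * Fintype.card (S × A × S))) * (τ + 2),
    by positivity, fun T => ?_⟩
  set n := ⌈(T : ℝ) / τ⌉₊ * τ with hn
  have hnT : (n : ℝ) ≤ (T + τ : ℕ) := by exact_mod_cast ceil_div_mul_le T τ
  have h1 := Finset.sum_le_sum fun k (_ : k ∈ Finset.range ⌈(T : ℝ) / τ⌉₊) =>
    integral_episodeRegret_le hmeas hrun k
  rw [← integral_finsetSum _ fun k _ => integrable_episodeRegret hmeas hrun k] at h1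
  rw [sum_range_mul_eq (fun t => τ * ∫ ω, initErr (τ := τ) Mstar M t ω ∂P +
        (∫ ω, rewardErr polOf Mstar M s t ω ∂P +
          τ * ∫ ω, transErr polOf Mstar M s t ω ∂P)), ← hn, Finset.sum_add_distrib,
    Finset.sum_add_distrib, ← Finset.mul_sum, ← Finset.mul_sum] at h1
  have hI := mul_le_mul_of_nonneg_left (sum_integral_initErr_le hmeas hrun n)
    (Nat.cast_nonneg (α := ℝ) τ)
  have hR := sum_integral_rewardErr_le hmeas hrun n
  have hT := mul_le_mul_of_nonneg_left (sum_integral_transErr_le hmeas hrun n)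
    (Nat.cast_nonneg (α := ℝ) τ)
  have hB : √(n : ℝ) * (1 + 2 * Real.log (n + 1)) ≤
      √((T + τ : ℕ) : ℝ) * (1 + 2 * Real.log ((T + τ : ℕ) + 1)) := by
    have := Real.log_nonneg (show (1 : ℝ) ≤ n + 1 by linarith [Nat.cast_nonneg (α := ℝ) n])
    gcongr
  refine le_trans (h1.trans ?_) (mul_le_mul_of_nonneg_left hB (by positivity))
  linarith

theorem tendsto_integral_regret_div (hmeas : Measurable polOf)
    (hrun : IsRun P f polOf Mstar M s r) (hopt : ∀ M : MDP S A, M.IsOptimal (polOf M))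
    {α : ℝ} (hα : 1 / 2 < α) :
    Tendsto (fun T : ℕ => (∫ ω, regret polOf Mstar M T ω ∂P) / (T : ℝ) ^ α) atTop (𝓝 0) := by
  obtain ⟨C, hC, h⟩ := exists_integral_regret_le hmeas hrun
  have hD : (0 : ℝ) < τ + 2 := by positivity
  -- For `T ≥ 1`, `T + τ + 1 ≤ (τ + 2) * T`, so the limit can be taken in the single variable `(τ +
  -- 2) * T`.
  have hlim : Tendsto (fun T : ℕ => C * (τ + 2 : ℝ) ^ α *
      (√((τ + 2) * T) * (1 + 2 * Real.log ((τ + 2) * T)) / ((τ + 2) * T) ^ α)) atTop (𝓝 0) := by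
    have := ((tendsto_sqrt_mul_log_div_rpow hα).comp
      (tendsto_natCast_atTop_atTop.const_mul_atTop hD)).const_mul (C * (τ + 2 : ℝ) ^ α)
    simpa using this
  refine squeeze_zero' (Eventually.of_forall fun T => ?_) ?_ hlim
  · exact div_nonneg (integral_nonneg fun ω => regret_nonneg hopt T ω)
      (Real.rpow_nonneg (Nat.cast_nonneg T) _)
  · filter_upwards [eventually_ge_atTop 1] with T hT
    have hT1 : (1 : ℝ) ≤ T := by exact_mod_cast hT
    have hTα : 0 < (T : ℝ) ^ α := Real.rpow_pos_of_pos (by linarith) _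
    have hτ := Nat.cast_nonneg (α := ℝ) τ
    have h1 : ((T + τ : ℕ) : ℝ) + 1 ≤ (τ + 2) * T := by
      push_cast
      nlinarith
    have h2 : √((T + τ : ℕ) : ℝ) * (1 + 2 * Real.log ((T + τ : ℕ) + 1)) ≤
        √((τ + 2) * T) * (1 + 2 * Real.log ((τ + 2) * T)) := by
      have h3 : (0 : ℝ) ≤ (T + τ : ℕ) := Nat.cast_nonneg _
      have := Real.log_nonneg (show (1 : ℝ) ≤ (T + τ : ℕ) + 1 by linarith)
      gcongr
      linarith
    rw [Real.mul_rpow hD.le (by linarith), div_le_iff₀ hTα]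
    refine (h T).trans ((mul_le_mul_of_nonneg_left h2 hC).trans_eq ?_)
    have : 0 < (τ + 2 : ℝ) ^ α := Real.rpow_pos_of_pos hD _
    field_simp

end PSRL

end

theorem mainTheorem4 {S A Ω : Type*} [Fintype S] [Fintype A]
    [MeasurableSpace S] [DiscreteMeasurableSpace S]
    [MeasurableSpace A] [DiscreteMeasurableSpace A]
    (τ : ℕ) [NeZero τ]
    [MeasurableSpace Ω] (P : Measure Ω) [IsProbabilityMeasure P]
    (polOf : MDP S A → Policy S A τ) (hmeas : Measurable polOf)
    (hopt : ∀ M : MDP S A, M.IsOptimal (polOf M))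
    (f : Measure (MDP S A))
    (Mstar : Ω → MDP S A) (M : ℕ → Ω → MDP S A)
    (s : ℕ → Ω → S) (r : ℕ → Ω → Set.Icc (0 : ℝ) 1)
    (hrun : PSRL.IsRun P f polOf Mstar M s r)
    (𝓜 : Set (MDP S A)) (h𝓜 : MeasurableSet 𝓜) (hpos : 0 < f 𝓜)
    (ε : ℝ) (hε : 0 < ε) (α : ℝ) (hα : 1 / 2 < α) :
    Tendsto
      (fun T : ℕ =>
        ProbabilityTheory.cond P (Mstar ⁻¹' 𝓜)
          {ω | PSRL.regret polOf Mstar M T ω / (T : ℝ) ^ α > ε})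
      atTop (𝓝 0) := by
  have hA : MeasurableSet (Mstar ⁻¹' 𝓜) := hrun.measurable_true h𝓜
  have hPA : P (Mstar ⁻¹' 𝓜) ≠ 0 := by
    rw [← Measure.map_apply hrun.measurable_true h𝓜, hrun.law_true]
    exact hpos.ne'
  have hlim : Tendsto (fun T : ℕ => (P (Mstar ⁻¹' 𝓜))⁻¹ * ENNReal.ofReal
      (ε⁻¹ * ((∫ ω, PSRL.regret polOf Mstar M T ω ∂P) / (T : ℝ) ^ α))) atTop (𝓝 0) := by
    have h1 := (PSRL.tendsto_integral_regret_div hmeas hrun hopt hα).const_mul ε⁻¹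
    rw [mul_zero] at h1
    have h2 := ENNReal.Tendsto.const_mul (ENNReal.tendsto_ofReal h1)
      (Or.inr (ENNReal.inv_ne_top.2 hPA))
    simpa using h2
  refine tendsto_of_tendsto_of_tendsto_of_le_of_le tendsto_const_nhds hlim (fun _ => zero_le)
    fun T => ?_
  rw [ProbabilityTheory.cond_apply hA]
  -- The conditioning event is dropped from the intersection at the price of the constant factor;
  -- Markov's inequality bounds the rest.
  refine mul_le_mul_right ((measure_mono Set.inter_subset_right).trans ?_) _
  have h0 : ∀ ω, 0 ≤ PSRL.regret polOf Mstar M T ω / (T : ℝ) ^ α := fun ω =>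
    div_nonneg (PSRL.regret_nonneg hopt T ω) (Real.rpow_nonneg (Nat.cast_nonneg T) _)
  have h1 := mul_meas_ge_le_integral_of_nonneg (ae_of_all P h0)
    ((PSRL.integrable_regret hmeas hrun T).div_const _) ε
  rw [integral_div] at h1
  rw [← ofReal_measureReal]
  refine ENNReal.ofReal_le_ofReal ?_
  rw [inv_mul_eq_div, le_div_iff₀' hε]
  refine (mul_le_mul_of_nonneg_left (measureReal_mono fun ω (hω : ε < _) => ?_) hε.le).trans h1
  exact hω.le
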